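/- For a finite non-empty set $P$ of points in the plane, let $\mathrm{sky}(P)=\{p\in P : \forall q\in P\setminus\{p\},\ x(q)<x(p)\text{ or }y(q)<y(p)\}$ be its skyline. For $Q\subseteq \mathrm{sky}(P)$ let $\psi(Q,P)=\max_{p\in \mathrm{sky}(P)}\min_{q\in Q} d(p,q)$, where $d$ is the Euclidean distance (and a minimum over the empty set is $\infty$), and let $\mathrm{opt}(P,k)=\min\{\psi(Q,P) : Q\subseteq \mathrm{sky}(P),\ |Q|\le k\}$. **Theorem.** Given a set $P$ of $n\ge 1$ points in the plane, a positive integer $k$ and a real value $\lambda\ge 0$, one can decide in $O(n\log k)$ time whether $\mathrm{opt}(P,k)\le\lambda$, where for $k=1$ the bound is read as $O(n)$. Precisely: there are one program of a real RAM and one constant $C$ such that for all $n\ge 1$, all sequences of $n$ distinct points with underlying set $P$, all integers $k\ge 1$ and all reals $\lambda\ge 0$, the program, started with $n$, $k$, $\lambda$ and the coordinates of the points in its memory, halts after at most $C\,n\log(k+1)$ steps and outputs $1$ if $\mathrm{opt}(P,k)\le\lambda$ and $0$ if $\mathrm{opt}(P,k)>\lambda$. The real RAM has registers and arrays of exact reals,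 with unit-cost addition, subtraction, multiplication and comparison, and registers and arrays of $w$-bit words, with unit-cost word arithmetic and comparison, arrays being addressed by words; the program works for every word size $w$ with $2^w\ge C\,(n+k)$. -/

import Mathlib

open scoped ENNReal

/-! ### Skylines and their representatives -/

/-- The Euclidean plane; `p 0` and `p 1` are the `x`- and the `y`-coordinate of `p`. -/
abbrev Plane := EuclideanSpace ℝ (Fin 2)

/-- The skyline (Pareto front) of `P`: the points of `P` that no other point of `P` dominates. -/
def sky (P : Set Plane) : Set Plane :=
  {p | p ∈ P ∧ ∀ q ∈ P, q ≠ p → q 0 < p 0 ∨ q 1 < p 1}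

/-- `ψ(Q, P)`: the maximum over `p ∈ sky P` of the minimum over `q ∈ Q` of the Euclidean distance
from `p` to `q`. The value lies in `[0, ∞]`, where a minimum over the empty set is `∞`; for finite
sets the supremum and the infimum are a maximum and a minimum. -/
noncomputable def psi (Q P : Set Plane) : ℝ≥0∞ :=
  ⨆ p ∈ sky P, ⨅ q ∈ Q, edist p q

/-- `opt(P, k)`: the minimum of `ψ(Q, P)` over all `Q ⊆ sky P` with at most `k` elements. -/
noncomputable def opt (P : Set Plane) (k : ℕ) : ℝ≥0∞ :=
  ⨅ (Q : Set Plane) (_ : Q ⊆ sky P) (_ : Q.encard ≤ k), psi Q P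

/-! ### The real RAM

A program is a structured program over finitely many registers and finitely many arrays. A register
or an array cell holds either a *word*, which is a natural number below `2 ^ w` for the word size
`w`, or an exact real number. Arrays are addressed by words only. Words carry the usual arithmetic;
reals carry addition, subtraction, multiplication and comparison, and cannot be converted to words
(no rounding). Division and roots of reals are not provided either: fewer operations only
strengthen the assertion that a program exists. Each elementary operation costs one step. -/

namespace RealRAM

/-- The contents of the memory: registers and arrays, of words and of reals. The first argument of
`warr` and `rarr` is the name of the array (fixed in the program text), the second the index. -/
@[ext] structure State where
  wreg : ℕ → ℕ
  rreg : ℕ → ℝ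
  warr : ℕ → ℕ → ℕ
  rarr : ℕ → ℕ → ℝ

/-- Word expressions. -/
inductive WExp where
  | const (c : ℕ)
  | reg (v : ℕ)
  | read (a : ℕ) (i : WExp)
  | add (e f : WExp)
  | sub (e f : WExp)
  | mul (e f : WExp)
  | div (e f : WExp)

/-- Real expressions. -/
inductive RExp where
  | const (c : ℤ)
  | reg (v : ℕ)
  | read (a : ℕ) (i : WExp)
  | add (e f : RExp)
  | sub (e f : RExp)
  | mul (e f : RExp)

/-- Tests. -/
inductive BExp where
  | wlt (e f : WExp)
  | rlt (e f : RExp)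
  | not (b : BExp)
  | and (b c : BExp)
  | or (b c : BExp)

/-- Value of a word expression for word size `w`: sums and products are reduced modulo `2 ^ w`,
differences are truncated at `0`, division rounds down. -/
def WExp.eval (w : ℕ) (s : State) : WExp → ℕ
  | .const c => c % 2 ^ w
  | .reg v => s.wreg v
  | .read a i => s.warr a (i.eval w s)
  | .add e f => (e.eval w s + f.eval w s) % 2 ^ w
  | .sub e f => e.eval w s - f.eval w s
  | .mul e f => (e.eval w s * f.eval w s) % 2 ^ w
  | .div e f => e.eval w s / f.eval w s

/-- Number of steps for evaluating a word expression. -/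
def WExp.cost : WExp → ℕ
  | .const _ => 1
  | .reg _ => 1
  | .read _ i => i.cost + 1
  | .add e f => e.cost + f.cost + 1
  | .sub e f => e.cost + f.cost + 1
  | .mul e f => e.cost + f.cost + 1
  | .div e f => e.cost + f.cost + 1

/-- Value of a real expression. -/
def RExp.eval (w : ℕ) (s : State) : RExp → ℝ
  | .const c => (c : ℝ)
  | .reg v => s.rreg v
  | .read a i => s.rarr a (i.eval w s)
  | .add e f => e.eval w s + f.eval w s
  | .sub e f => e.eval w s - f.eval w s
  | .mul e f => e.eval w s * f.eval w s

/-- Number of steps for evaluating a real expression. -/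
def RExp.cost : RExp → ℕ
  | .const _ => 1
  | .reg _ => 1
  | .read _ i => i.cost + 1
  | .add e f => e.cost + f.cost + 1
  | .sub e f => e.cost + f.cost + 1
  | .mul e f => e.cost + f.cost + 1

/-- Truth of a test. -/
def BExp.Holds (w : ℕ) (s : State) : BExp → Prop
  | .wlt e f => e.eval w s < f.eval w s
  | .rlt e f => e.eval w s < f.eval w s
  | .not b => ¬ b.Holds w s
  | .and b c => b.Holds w s ∧ c.Holds w s
  | .or b c => b.Holds w s ∨ c.Holds w s

/-- Number of steps for evaluating a test. -/
def BExp.cost : BExp → ℕ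
  | .wlt e f => e.cost + f.cost + 1
  | .rlt e f => e.cost + f.cost + 1
  | .not b => b.cost + 1
  | .and b c => b.cost + c.cost + 1
  | .or b c => b.cost + c.cost + 1

/-- Programs: assignments to registers and to array cells, composition, branching, while loops. -/
inductive Program where
  | skip
  | wset (v : ℕ) (e : WExp)
  | rset (v : ℕ) (e : RExp)
  | wstore (a : ℕ) (i e : WExp)
  | rstore (a : ℕ) (i : WExp) (e : RExp)
  | seq (c d : Program)
  | branch (b : BExp) (c d : Program)
  | loop (b : BExp) (c : Program)

/-- `Exec w c s t s'`: on word size `w`, the program `c` started in the state `s` halts after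
exactly `t` steps in the state `s'`. -/
inductive Exec (w : ℕ) : Program → State → ℕ → State → Prop
  | skip (s : State) : Exec w .skip s 1 s
  | wset (v : ℕ) (e : WExp) (s : State) :
      Exec w (.wset v e) s (e.cost + 1)
        { s with wreg := Function.update s.wreg v (e.eval w s) }
  | rset (v : ℕ) (e : RExp) (s : State) :
      Exec w (.rset v e) s (e.cost + 1)
        { s with rreg := Function.update s.rreg v (e.eval w s) }
  | wstore (a : ℕ) (i e : WExp) (s : State) :
      Exec w (.wstore a i e) s (i.cost + e.cost + 1)
        { s with warr :=
            Function.update s.warr a (Function.update (s.warr a) (i.eval w s) (e.eval w s)) }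
  | rstore (a : ℕ) (i : WExp) (e : RExp) (s : State) :
      Exec w (.rstore a i e) s (i.cost + e.cost + 1)
        { s with rarr :=
            Function.update s.rarr a (Function.update (s.rarr a) (i.eval w s) (e.eval w s)) }
  | seq {c d : Program} {s s' s'' : State} {t t' : ℕ} :
      Exec w c s t s' → Exec w d s' t' s'' → Exec w (.seq c d) s (t + t') s''
  | branch_true {b : BExp} {c : Program} (d : Program) {s s' : State} {t : ℕ} :
      b.Holds w s → Exec w c s t s' → Exec w (.branch b c d) s (b.cost + t + 1) s'
  | branch_false {b : BExp} (c : Program) {d : Program} {s s' : State} {t : ℕ} :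
      ¬ b.Holds w s → Exec w d s t s' → Exec w (.branch b c d) s (b.cost + t + 1) s'
  | loop_true {b : BExp} {c : Program} {s s' s'' : State} {t t' : ℕ} :
      b.Holds w s → Exec w c s t s' → Exec w (.loop b c) s' t' s'' →
        Exec w (.loop b c) s (b.cost + t + t' + 1) s''
  | loop_false {b : BExp} (c : Program) {s : State} :
      ¬ b.Holds w s → Exec w (.loop b c) s (b.cost + 1) s

/-- Computations are deterministic: final state and number of steps are determined by the start. -/
theorem Exec.deterministic {w : ℕ} {c : Program} {s s₁ s₂ : State} {t₁ t₂ : ℕ}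
    (h₁ : Exec w c s t₁ s₁) (h₂ : Exec w c s t₂ s₂) : t₁ = t₂ ∧ s₁ = s₂ := by
  induction h₁ generalizing t₂ s₂ with
  | skip | wset | rset | wstore | rstore => cases h₂; exact ⟨rfl, rfl⟩
  | seq _ _ ih ih' =>
    cases h₂ with
    | seq a b =>
      obtain ⟨rfl, rfl⟩ := ih a
      obtain ⟨rfl, rfl⟩ := ih' b
      exact ⟨rfl, rfl⟩
  | branch_true _ hb _ ih =>
    cases h₂ with
    | branch_true _ _ a => obtain ⟨rfl, rfl⟩ := ih a; exact ⟨rfl, rfl⟩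
    | branch_false _ hb' => exact absurd hb hb'
  | branch_false _ hb _ ih =>
    cases h₂ with
    | branch_true _ hb' => exact absurd hb' hb
    | branch_false _ _ a => obtain ⟨rfl, rfl⟩ := ih a; exact ⟨rfl, rfl⟩
  | loop_true hb _ _ ih ih' =>
    cases h₂ with
    | loop_true _ a b =>
      obtain ⟨rfl, rfl⟩ := ih a
      obtain ⟨rfl, rfl⟩ := ih' b
      exact ⟨rfl, rfl⟩
    | loop_false _ hb' => exact absurd hb hb'
  | loop_false _ hb =>
    cases h₂ with
    | loop_true hb' => exact absurd hb' hb
    | loop_false => exact ⟨rfl, rfl⟩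

end RealRAM

/-- The start state for an instance of the decision problem: the words `n` and `k` are in the word
registers `0` and `1`, the real `r` is in the real register `0`, the coordinates of the `n` points
are listed in the real arrays `0` (`x`-coordinates) and `1` (`y`-coordinates), and the rest of the
memory is `0`. -/
noncomputable def decisionInput {n : ℕ} (p : Fin n → Plane) (k : ℕ) (r : ℝ) : RealRAM.State where
  wreg v := if v = 0 then n else if v = 1 then k else 0
  rreg v := if v = 0 then r else 0
  warr _ _ := 0
  rarr a i :=
    if h : i < n then (if a = 0 then p ⟨i, h⟩ 0 else if a = 1 then p ⟨i, h⟩ 1 else 0) else 0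

/-! A skyline descends to the right, so distances along it are monotone under nesting: if `a, b, c,
d` are skyline points from left to right, then `b` and `c` are at most as far apart as `a` and `d`.
Hence a disc centred on the skyline covers a contiguous stretch of it, and the greedy covering is
optimal (`coverable_succ_iff`). Let `l` be the leftmost uncovered point, `f` the first point to its
right that is farther than `λ` from `l`, and `c` the last point before `f`. The next centre is `c`,
and the next uncovered point is the first point `m` to the right of `c` that is farther than `λ`
from `c`. So `opt ≤ λ` exactly if at most `k` rounds reach the end.

Sorting all points would cost `n log n`. Instead `k` is replaced by `min k n`, and only blocks of a
length `W` are sorted, where `W` is a power of two that is at least `min k n`; bottom-up merging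
takes about `log k` linear passes (`exec_sortBlocks`). A sweep from the right turns each block into
a descending staircase and preserves the global skyline (`StairInv.front_eq`, `exec_stairs`).

A round asks a bounded number of queries for the points `f`, `c`, `m`. Each is answered by visiting
all blocks, with one pointer per block (`exec_passNear`, `exec_findNext`, `exec_findLast`). The
queries move to the right, so the pointers never retreat and their advances cost `O(n)` in total
(`exec_scan`, with potential `pending`). The visits cost `O(n / W + 1)` per round, hence `O(n)` for
all rounds, because `min k n ≤ W`. Only squared distances are compared, so no roots are needed. -/

namespace RealRAM

/-! ### Reasoning about programs -/

/-- Upper bound on the number of steps of a loop-free program. -/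
def Program.bound : Program → ℕ
  | .skip => 1
  | .wset _ e => e.cost + 1
  | .rset _ e => e.cost + 1
  | .wstore _ i e => i.cost + e.cost + 1
  | .rstore _ i e => i.cost + e.cost + 1
  | .seq c d => c.bound + d.bound
  | .branch b c d => b.cost + (c.bound + d.bound) + 1
  | .loop _ _ => 0

/-- Weakest precondition of a loop-free program. -/
def Program.wp (w : ℕ) : Program → (State → Prop) → State → Prop
  | .skip, Q, s => Q s
  | .wset v e, Q, s => Q { s with wreg := Function.update s.wreg v (e.eval w s) }
  | .rset v e, Q, s => Q { s with rreg := Function.update s.rreg v (e.eval w s) }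
  | .wstore a i e, Q, s => Q
      { s with warr :=
          Function.update s.warr a (Function.update (s.warr a) (i.eval w s) (e.eval w s)) }
  | .rstore a i e, Q, s => Q
      { s with rarr :=
          Function.update s.rarr a (Function.update (s.rarr a) (i.eval w s) (e.eval w s)) }
  | .seq c d, Q, s => c.wp w (d.wp w Q) s
  | .branch b c d, Q, s => (b.Holds w s → c.wp w Q s) ∧ (¬ b.Holds w s → d.wp w Q s)
  | .loop _ _, _, _ => False

/-- For a concrete loop-free program the precondition unfolds by simplification and `bound` is a
numeral. Loops have precondition `False`, so their value `0` in `bound` is never used. -/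
theorem Program.exec_of_wp {w : ℕ} (c : Program) {Q : State → Prop} {s : State}
    (h : c.wp w Q s) : ∃ t s', Exec w c s t s' ∧ t ≤ c.bound ∧ Q s' := by
  induction c generalizing s Q with
  | skip => exact ⟨_, _, .skip s, le_rfl, h⟩
  | wset v e => exact ⟨_, _, .wset v e s, le_rfl, h⟩
  | rset v e => exact ⟨_, _, .rset v e s, le_rfl, h⟩
  | wstore a i e => exact ⟨_, _, .wstore a i e s, le_rfl, h⟩
  | rstore a i e => exact ⟨_, _, .rstore a i e s, le_rfl, h⟩
  | seq c d ihc ihd =>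
    obtain ⟨t, s', e, ht, h'⟩ := ihc h
    obtain ⟨t', s'', e', ht', h''⟩ := ihd h'
    exact ⟨_, _, .seq e e', Nat.add_le_add ht ht', h''⟩
  | branch b c d ihc ihd =>
    by_cases hb : b.Holds w s
    · obtain ⟨t, s', e, ht, h'⟩ := ihc (h.1 hb)
      exact ⟨_, _, .branch_true d hb e, by simp only [bound]; omega, h'⟩
    · obtain ⟨t, s', e, ht, h'⟩ := ihd (h.2 hb)
      exact ⟨_, _, .branch_false c hb e, by simp only [bound]; omega, h'⟩
  | loop b c => exact h.elim

/-- The implication between postconditions may use the execution itself. This brings in frame facts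
when `c` is a variable, as in `exec_scan`. -/
theorem Program.wp_mono_exec {w : ℕ} {c : Program} {Q R : State → Prop} {s : State}
    (h : c.wp w Q s) (hQR : ∀ t s', Exec w c s t s' → Q s' → R s') : c.wp w R s := by
  induction c generalizing s Q R with
  | skip => exact hQR _ _ (.skip s) h
  | wset v e => exact hQR _ _ (.wset v e s) h
  | rset v e => exact hQR _ _ (.rset v e s) h
  | wstore a i e => exact hQR _ _ (.wstore a i e s) h
  | rstore a i e => exact hQR _ _ (.rstore a i e s) h
  | seq c d ihc ihd => exact ihc h fun _ _ e h' => ihd h' fun _ _ e' => hQR _ _ (.seq e e')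
  | branch b c d ihc ihd =>
    exact ⟨fun hb => ihc (h.1 hb) fun _ _ e => hQR _ _ (.branch_true d hb e),
      fun hb => ihd (h.2 hb) fun _ _ e => hQR _ _ (.branch_false c hb e)⟩
  | loop b c => exact h.elim

theorem Program.wp_mono {w : ℕ} {c : Program} {Q R : State → Prop} {s : State} (h : c.wp w Q s)
    (hQR : ∀ s', Q s' → R s') : c.wp w R s :=
  wp_mono_exec h fun _ s' _ => hQR s'

/-- Does the program text contain an assignment to the word register `v`? -/
def Program.setsW : Program → ℕ → Bool
  | .wset u _, v => u == v
  | .seq c d, v => c.setsW v || d.setsW v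
  | .branch _ c d, v => c.setsW v || d.setsW v
  | .loop _ c, v => c.setsW v
  | _, _ => false

/-- Does the program text contain an assignment to the real register `v`? -/
def Program.setsR : Program → ℕ → Bool
  | .rset u _, v => u == v
  | .seq c d, v => c.setsR v || d.setsR v
  | .branch _ c d, v => c.setsR v || d.setsR v
  | .loop _ c, v => c.setsR v
  | _, _ => false

/-- Does the program text contain an assignment to a cell of the word array `a`? -/
def Program.storesW : Program → ℕ → Bool
  | .wstore a _ _, v => a == v
  | .seq c d, v => c.storesW v || d.storesW v
  | .branch _ c d, v => c.storesW v || d.storesW v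
  | .loop _ c, v => c.storesW v
  | _, _ => false

/-- Does the program text contain an assignment to a cell of the real array `a`? -/
def Program.storesR : Program → ℕ → Bool
  | .rstore a _ _, v => a == v
  | .seq c d, v => c.storesR v || d.storesR v
  | .branch _ c d, v => c.storesR v || d.storesR v
  | .loop _ c, v => c.storesR v
  | _, _ => false

/-- The states `s` and `s'` agree on all registers and arrays that `c` does not assign to. -/
structure Frame (c : Program) (s s' : State) : Prop where
  wreg : ∀ v, c.setsW v = false → s'.wreg v = s.wreg v
  rreg : ∀ v, c.setsR v = false → s'.rreg v = s.rreg v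
  warr : ∀ v, c.storesW v = false → s'.warr v = s.warr v
  rarr : ∀ v, c.storesR v = false → s'.rarr v = s.rarr v

theorem Frame.refl (c : Program) (s : State) : Frame c s s :=
  ⟨fun _ _ => rfl, fun _ _ => rfl, fun _ _ => rfl, fun _ _ => rfl⟩

theorem Frame.trans {c : Program} {s s' s'' : State} (h : Frame c s s') (h' : Frame c s' s'') :
    Frame c s s'' :=
  ⟨fun v hv => (h'.wreg v hv).trans (h.wreg v hv), fun v hv => (h'.rreg v hv).trans (h.rreg v hv),
    fun v hv => (h'.warr v hv).trans (h.warr v hv), fun v hv => (h'.rarr v hv).trans (h.rarr v hv)⟩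

theorem Frame.mono {c d : Program} {s s' : State} (h : Frame c s s')
    (hw : ∀ v, d.setsW v = false → c.setsW v = false)
    (hr : ∀ v, d.setsR v = false → c.setsR v = false)
    (haw : ∀ v, d.storesW v = false → c.storesW v = false)
    (har : ∀ v, d.storesR v = false → c.storesR v = false) : Frame d s s' :=
  ⟨fun v hv => h.wreg v (hw v hv), fun v hv => h.rreg v (hr v hv),
    fun v hv => h.warr v (haw v hv), fun v hv => h.rarr v (har v hv)⟩

/-- The targets of assignments are read off the program text by Boolean functions, so for concrete
programs the side conditions of `Frame` are discharged by `rfl`. -/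
theorem Exec.frame {w : ℕ} {c : Program} {s s' : State} {t : ℕ} (h : Exec w c s t s') :
    Frame c s s' := by
  induction h with
  | skip s => exact .refl _ _
  | wset v e s | rset v e s | wstore v i e s | rstore v i e s =>
    constructor <;> intro u hu <;>
      simp_all [Program.setsW, Program.setsR, Program.storesW, Program.storesR,
        Function.update_of_ne, Ne.symm]
  | seq _ _ ih ih' =>
    refine (ih.mono ?_ ?_ ?_ ?_).trans (ih'.mono ?_ ?_ ?_ ?_) <;> intro v hv <;>
      simp_all [Program.setsW, Program.setsR, Program.storesW, Program.storesR]
  | branch_true _ _ _ ih | branch_false _ _ _ ih =>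
    refine ih.mono ?_ ?_ ?_ ?_ <;> intro v hv <;>
      simp_all [Program.setsW, Program.setsR, Program.storesW, Program.storesR]
  | loop_true _ _ _ ih ih' => exact Frame.trans ⟨ih.wreg, ih.rreg, ih.warr, ih.rarr⟩ ih'
  | loop_false => exact .refl _ _

/-- Loop rule: `I` is an invariant and `μ` a potential that pays for the steps. -/
theorem exec_loop {w : ℕ} {b : BExp} {c : Program} (I : State → Prop) (μ : State → ℕ)
    {s₀ : State} (h₀ : I s₀)
    (hstep : ∀ s, Frame c s₀ s → I s → b.Holds w s →
      ∃ t s', Exec w c s t s' ∧ I s' ∧ b.cost + t + 1 + μ s' ≤ μ s) :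
    ∃ t s', Exec w (.loop b c) s₀ t s' ∧ Frame c s₀ s' ∧ I s' ∧ ¬ b.Holds w s' ∧
      t + μ s' ≤ μ s₀ + (b.cost + 1) := by
  -- Each iteration lowers `μ` by at least its own positive cost, so induction on a bound for `μ`
  -- yields termination together with the step count.
  suffices H : ∀ m s, μ s ≤ m → Frame c s₀ s → I s →
      ∃ t s', Exec w (.loop b c) s t s' ∧ Frame c s₀ s' ∧ I s' ∧ ¬ b.Holds w s' ∧
        t + μ s' ≤ μ s + (b.cost + 1) from H _ s₀ le_rfl (.refl _ _) h₀
  intro m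
  induction m with
  | zero =>
    intro s hs hf hI
    by_cases hb : b.Holds w s
    · obtain ⟨t, s', _, _, h⟩ := hstep s hf hI hb
      omega
    · exact ⟨_, s, .loop_false c hb, hf, hI, hb, by omega⟩
  | succ m ih =>
    intro s hs hf hI
    by_cases hb : b.Holds w s
    · obtain ⟨t, s', e, hI', h⟩ := hstep s hf hI hb
      obtain ⟨t', s'', e', hf', hI'', hb', h'⟩ := ih s' (by omega) (hf.trans e.frame) hI'
      exact ⟨_, s'', .loop_true hb e e', hf', hI'', hb', by omega⟩
    · exact ⟨_, s, .loop_false c hb, hf, hI, hb, by omega⟩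

/-- Loop rule for a loop-free body: each iteration decreases the variant `ν`. -/
theorem exec_loop_of_wp {w : ℕ} {b : BExp} {c : Program} (I : State → Prop) (ν : State → ℕ)
    {s₀ : State} (h₀ : I s₀)
    (hstep : ∀ s, Frame c s₀ s → I s → b.Holds w s → c.wp w (fun s' => I s' ∧ ν s' < ν s) s) :
    ∃ t s', Exec w (.loop b c) s₀ t s' ∧ Frame c s₀ s' ∧ I s' ∧ ¬ b.Holds w s' ∧
      t + (b.cost + c.bound + 1) * ν s' ≤ (b.cost + c.bound + 1) * (ν s₀ + 1) := by
  obtain ⟨t, s', e, hf, hI, hb, h⟩ := exec_loop (w := w) (b := b) (c := c) I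
    (fun s => (b.cost + c.bound + 1) * ν s) h₀ fun s hf hI hb => by
      obtain ⟨t, s', e, ht, hI', hν⟩ := c.exec_of_wp (hstep s hf hI hb)
      refine ⟨t, s', e, hI', ?_⟩
      have := Nat.mul_le_mul_left (b.cost + c.bound + 1) (Nat.succ_le_of_lt hν)
      rw [Nat.succ_eq_add_one, mul_add, mul_one] at this
      omega
  refine ⟨t, s', e, hf, hI, hb, ?_⟩
  rw [mul_add, mul_one]
  omega

end RealRAM

/-! ### The greedy covering of a skyline -/

/-- The skyline of the family of points `(X j, Y j)`, `j < n`. -/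
def front (X Y : ℕ → ℝ) (n : ℕ) : Set (ℝ × ℝ) :=
  {p | (∃ j < n, X j = p.1 ∧ Y j = p.2) ∧
    ∀ j < n, X j < p.1 ∨ Y j < p.2 ∨ (X j = p.1 ∧ Y j = p.2)}

/-- Squared Euclidean distance. -/
def sqDist (p q : ℝ × ℝ) : ℝ := (p.1 - q.1) * (p.1 - q.1) + (p.2 - q.2) * (p.2 - q.2)

theorem sqDist_comm (p q : ℝ × ℝ) : sqDist p q = sqDist q p := by
  unfold sqDist; ring

/-- Both coordinate differences of the inner pair are at most those of the outer pair. This is the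
only geometric fact about distances that the algorithm needs. -/
theorem sqDist_le_of_nested {a b c d : ℝ × ℝ} (hab : a.1 ≤ b.1) (hbc : b.1 ≤ c.1)
    (hcd : c.1 ≤ d.1) (hab' : b.2 ≤ a.2) (hbc' : c.2 ≤ b.2) (hcd' : d.2 ≤ c.2) :
    sqDist b c ≤ sqDist a d := by
  have h₁ : (c.1 - b.1) * (c.1 - b.1) ≤ (d.1 - a.1) * (d.1 - a.1) :=
    mul_self_le_mul_self (by linarith) (by linarith)
  have h₂ : (b.2 - c.2) * (b.2 - c.2) ≤ (a.2 - d.2) * (a.2 - d.2) :=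
    mul_self_le_mul_self (by linarith) (by linarith)
  unfold sqDist
  nlinarith

/-- A descending staircase: of two distinct points, the one further to the right is lower. -/
def Staircase (S : Set (ℝ × ℝ)) : Prop :=
  ∀ p ∈ S, ∀ q ∈ S, p.1 ≤ q.1 → q.2 ≤ p.2 ∧ (p.1 = q.1 → p = q)

theorem staircase_front (X Y : ℕ → ℝ) (n : ℕ) : Staircase (front X Y n) := by
  rintro p ⟨⟨i, hi, hip⟩, hp⟩ q ⟨⟨j, hj, hjq⟩, hq⟩ hpq
  have h₁ := hp j hj
  have h₂ := hq i hi
  rw [hjq.1, hjq.2] at h₁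
  rw [hip.1, hip.2] at h₂
  constructor
  · rcases h₁ with h | h | h <;> linarith
  · intro h
    ext
    · exact h
    · rcases h₁ with h₁ | h₁ | h₁ <;> rcases h₂ with h₂ | h₂ | h₂ <;> linarith

theorem Staircase.sqDist_le {S : Set (ℝ × ℝ)} (hS : Staircase S) {a b c d : ℝ × ℝ}
    (ha : a ∈ S) (hb : b ∈ S) (hc : c ∈ S) (hd : d ∈ S) (hab : a.1 ≤ b.1) (hbc : b.1 ≤ c.1)
    (hcd : c.1 ≤ d.1) : sqDist b c ≤ sqDist a d :=
  sqDist_le_of_nested hab hbc hcd (hS a ha b hb hab).1 (hS b hb c hc hbc).1 (hS c hc d hd hcd).1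

/-- At most `k` discs of radius `lam` centred in `S` cover the points of `S` from abscissa `a`
on. -/
def Coverable (S : Set (ℝ × ℝ)) (lam : ℝ) (k : ℕ) (a : ℝ) : Prop :=
  ∃ Q : Finset (ℝ × ℝ), ↑Q ⊆ S ∧ Q.card ≤ k ∧
    ∀ z ∈ S, a ≤ z.1 → ∃ q ∈ Q, sqDist q z ≤ lam * lam

theorem not_coverable_zero {S : Set (ℝ × ℝ)} {lam : ℝ} {l : ℝ × ℝ} (hl : l ∈ S) :
    ¬ Coverable S lam 0 l.1 := by
  rintro ⟨Q, -, hQ, h⟩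
  obtain ⟨q, hq, -⟩ := h l hl le_rfl
  simp_all

/-- The points between `l` and `c` are within reach of `c` by nesting, because `l` is. This is the
last round of the greedy algorithm. -/
theorem coverable_succ_of_forall {S : Set (ℝ × ℝ)} (hS : Staircase S) {lam : ℝ} {k : ℕ}
    {l c : ℝ × ℝ} (hl : l ∈ S) (hc : c ∈ S) (hd : sqDist l c ≤ lam * lam)
    (h : ∀ z ∈ S, c.1 ≤ z.1 → sqDist c z ≤ lam * lam) : Coverable S lam (k + 1) l.1 := by
  refine ⟨{c}, by simpa using hc, by simp, fun z hz hlz => ⟨c, by simp, ?_⟩⟩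
  rcases le_total c.1 z.1 with hcz | hcz
  · exact h z hz hcz
  · rw [sqDist_comm]
    exact (hS.sqDist_le hl hz hc hc hlz hcz le_rfl).trans hd

/-- The exchange argument. A centre `q` that covers `l` cannot lie to the right of `c`. If it
covered a point `z` from `m` on, then nesting in the order `q, c, m, z` would bring `m` within reach
of `c`. So `q` can be dropped when only the points from `m` on matter. Conversely, a disc at `c`
covers everything from `l` up to `m`. -/
theorem coverable_succ_iff {S : Set (ℝ × ℝ)} (hS : Staircase S) {lam : ℝ} {k : ℕ}
    {l c m : ℝ × ℝ} (hl : l ∈ S) (hc : c ∈ S) (hm : m ∈ S) (hlc : l.1 ≤ c.1) (hcm : c.1 ≤ m.1)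
    (hd : sqDist l c ≤ lam * lam) (hfar : ∀ z ∈ S, c.1 < z.1 → lam * lam < sqDist l z)
    (hm' : lam * lam < sqDist c m)
    (h : ∀ z ∈ S, c.1 ≤ z.1 → z.1 < m.1 → sqDist c z ≤ lam * lam) :
    Coverable S lam (k + 1) l.1 ↔ Coverable S lam k m.1 := by
  constructor
  · rintro ⟨Q, hQ, hk, hcov⟩
    obtain ⟨q, hq, hlq⟩ := hcov l hl le_rfl
    have hqc : q.1 ≤ c.1 := by
      by_contra! hlt
      have := hfar q (hQ hq) hlt
      rw [sqDist_comm] at this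
      linarith
    refine ⟨Q.erase q, fun z hz => hQ (Finset.mem_of_mem_erase hz), ?_, fun z hz hmz => ?_⟩
    · rw [Finset.card_erase_of_mem hq]; omega
    · obtain ⟨r, hr, hrz⟩ := hcov z hz (by linarith)
      refine ⟨r, Finset.mem_erase.2 ⟨?_, hr⟩, hrz⟩
      rintro rfl
      have := hS.sqDist_le (hQ hq) hc hm hz hqc hcm hmz
      linarith
  · rintro ⟨Q, hQ, hk, hcov⟩
    classical
    refine ⟨insert c Q, ?_, (Finset.card_insert_le _ _).trans (by omega), fun z hz hlz => ?_⟩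
    · intro z hz
      rcases Finset.mem_insert.1 (Finset.mem_coe.1 hz) with rfl | hz
      exacts [hc, hQ hz]
    · rcases le_or_gt m.1 z.1 with hmz | hmz
      · obtain ⟨q, hq, hqz⟩ := hcov z hz hmz
        exact ⟨q, Finset.mem_insert_of_mem hq, hqz⟩
      · refine ⟨c, Finset.mem_insert_self _ _, ?_⟩
        rcases le_total c.1 z.1 with hcz | hcz
        · exact h z hz hcz hmz
        · rw [sqDist_comm]
          exact (hS.sqDist_le hl hz hc hc hlz hcz le_rfl).trans hd

/-! ### From `opt` to coverings of the front in coordinates -/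

theorem edist_le_iff_sqDist_le {p q : Plane} {lam : ℝ} (hlam : 0 ≤ lam) :
    edist p q ≤ ENNReal.ofReal lam ↔ sqDist (q 0, q 1) (p 0, p 1) ≤ lam * lam := by
  rw [edist_dist, ENNReal.ofReal_le_ofReal_iff hlam, EuclideanSpace.dist_eq,
    Real.sqrt_le_left hlam]
  simp [Fin.sum_univ_two, Real.dist_eq, sq_abs, sqDist]
  constructor <;> intro h <;> nlinarith

theorem front_eq_image_sky {n : ℕ} (p : Fin n → Plane) {X Y : ℕ → ℝ}
    (hX : ∀ i : Fin n, X i = p i 0) (hY : ∀ i : Fin n, Y i = p i 1) :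
    front X Y n = (fun z : Plane => (z 0, z 1)) '' sky (Set.range p) := by
  have hext : ∀ a b : Plane, a 0 = b 0 → a 1 = b 1 → a = b := by
    intro a b h₀ h₁
    ext i
    fin_cases i
    exacts [h₀, h₁]
  ext z
  constructor
  · rintro ⟨⟨j, hj, h₀, h₁⟩, h⟩
    have e₀ : p ⟨j, hj⟩ 0 = z.1 := (hX ⟨j, hj⟩).symm.trans h₀
    have e₁ : p ⟨j, hj⟩ 1 = z.2 := (hY ⟨j, hj⟩).symm.trans h₁
    refine ⟨p ⟨j, hj⟩, ⟨⟨_, rfl⟩, ?_⟩, Prod.ext e₀ e₁⟩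
    rintro _ ⟨i, rfl⟩ hne
    have := h i i.2
    rw [hX, hY] at this
    rw [e₀, e₁]
    rcases this with h' | h' | ⟨h₀', h₁'⟩
    · exact .inl h'
    · exact .inr h'
    · exact absurd (hext _ _ (h₀'.trans e₀.symm) (h₁'.trans e₁.symm)) hne
  · rintro ⟨_, ⟨⟨i, rfl⟩, h⟩, rfl⟩
    refine ⟨⟨i, i.2, hX i, hY i⟩, fun j hj => ?_⟩
    rw [show X j = p ⟨j, hj⟩ 0 from hX ⟨j, hj⟩, show Y j = p ⟨j, hj⟩ 1 from hY ⟨j, hj⟩]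
    by_cases hne : p ⟨j, hj⟩ = p i
    · exact .inr (.inr ⟨by rw [hne], by rw [hne]⟩)
    · rcases h _ ⟨_, rfl⟩ hne with h' | h'
      exacts [.inl h', .inr (.inl h')]

/-- A finite skyline has finitely many subsets, and the empty one is always admissible, so the
infimum is attained. -/
theorem exists_psi_eq_opt {P : Set Plane} (hP : P.Finite) (k : ℕ) :
    ∃ Q ⊆ sky P, Q.encard ≤ k ∧ psi Q P = opt P k := by
  have hfin : {Q : Set Plane | Q ⊆ sky P ∧ Q.encard ≤ k}.Finite :=
    ((hP.subset fun z hz => hz.1).finite_subsets).subset fun Q hQ => hQ.1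
  obtain ⟨Q, hQ, hmin⟩ := hfin.exists_minimalFor (fun Q => psi Q P) _
    ⟨∅, Set.empty_subset _, by simp⟩
  refine ⟨Q, hQ.1, hQ.2, le_antisymm ?_ ?_⟩
  · refine le_iInf₂ fun R hR => le_iInf fun hR' => ?_
    rcases le_total (psi Q P) (psi R P) with h | h
    exacts [h, hmin ⟨hR, hR'⟩ h]
  · exact iInf₂_le_of_le Q hQ.1 (iInf_le _ hQ.2)

theorem psi_le_iff {P Q : Set Plane} (hQ : Q.Finite) {lam : ℝ} :
    psi Q P ≤ ENNReal.ofReal lam ↔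
      ∀ z ∈ sky P, ∃ q ∈ Q, edist z q ≤ ENNReal.ofReal lam := by
  unfold psi
  simp only [iSup_le_iff]
  refine forall₂_congr fun z _ => ⟨fun h => ?_, fun ⟨q, hq, h⟩ => iInf₂_le_of_le q hq h⟩
  rcases Q.eq_empty_or_nonempty with rfl | hne
  -- Without centres the infimum is `∞`, which no real radius bounds.
  · simp at h
  · obtain ⟨q, hq, hmin⟩ := hQ.exists_minimalFor (fun q => edist z q) _ hne
    refine ⟨q, hq, le_trans (le_iInf₂ fun r hr => ?_) h⟩
    rcases le_total (edist z q) (edist z r) with h | h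
    exacts [h, hmin hr h]

/-- The skyline has at most `n` points, so more than `n` centres are never needed and `k` can be
capped at `n`. The abscissa `a` excludes no point of the skyline. -/
theorem opt_le_iff_coverable {n : ℕ} (p : Fin n → Plane) (k : ℕ) {lam : ℝ} (hlam : 0 ≤ lam)
    {X Y : ℕ → ℝ} {S : Set (ℝ × ℝ)} (hS : S = front X Y n)
    (hX : ∀ i : Fin n, X i = p i 0) (hY : ∀ i : Fin n, Y i = p i 1) {a : ℝ}
    (ha : ∀ z ∈ S, a ≤ z.1) :
    opt (Set.range p) k ≤ ENNReal.ofReal lam ↔ Coverable S lam (min k n) a := by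
  classical
  have hext : Function.Injective (fun z : Plane => (z 0, z 1)) := by
    intro a b h
    ext i
    fin_cases i
    exacts [congrArg Prod.fst h, congrArg Prod.snd h]
  rw [front_eq_image_sky p hX hY] at hS
  subst hS
  have hfin : (Set.range p).Finite := Set.finite_range p
  have hsky : (sky (Set.range p)).Finite := hfin.subset fun z hz => hz.1
  have hn : (sky (Set.range p)).ncard ≤ n :=
    (Set.ncard_le_ncard (fun z hz => hz.1) hfin).trans
      (by rw [← Set.image_univ]; simpa using Set.ncard_image_le (f := p) (s := Set.univ))
  constructor
  · intro h
    obtain ⟨Q, hQ, hk, hopt⟩ := exists_psi_eq_opt hfin k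
    have hQf := hsky.subset hQ
    rw [← hopt, psi_le_iff hQf] at h
    refine ⟨hQf.toFinset.image fun z => (z 0, z 1), ?_, ?_, ?_⟩
    · intro z hz
      simp only [Finset.coe_image, Set.Finite.coe_toFinset] at hz
      exact Set.image_mono hQ hz
    · refine Finset.card_image_le.trans ?_
      rw [← Set.ncard_eq_toFinset_card Q hQf]
      refine le_min ?_ ((Set.ncard_le_ncard hQ hsky).trans hn)
      rw [← hQf.cast_ncard_eq] at hk
      exact_mod_cast hk
    · rintro _ ⟨z, hz, rfl⟩ -
      obtain ⟨q, hq, hd⟩ := h z hz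
      exact ⟨_, Finset.mem_image_of_mem _ (hQf.mem_toFinset.2 hq),
        (edist_le_iff_sqDist_le hlam).1 hd⟩
  · rintro ⟨Q, hQ, hk, h⟩
    set R : Set Plane := (fun z : Plane => (z 0, z 1)) ⁻¹' (Q : Set (ℝ × ℝ)) with hR
    have hRf : R.Finite := Q.finite_toSet.preimage hext.injOn
    have hRs : R ⊆ sky (Set.range p) := fun z hz => by
      obtain ⟨z', hz', e⟩ := hQ hz
      rwa [← hext e]
    refine le_trans (iInf₂_le_of_le R hRs (iInf_le _ ?_)) ((psi_le_iff hRf).2 fun z hz => ?_)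
    · rw [← Set.InjOn.encard_image hext.injOn]
      refine (Set.encard_le_encard (Set.image_preimage_subset _ _)).trans ?_
      rw [Set.encard_coe_eq_coe_finsetCard]
      exact_mod_cast hk.trans (min_le_left _ _)
    · obtain ⟨q, hq, hd⟩ := h _ ⟨z, hz, rfl⟩ (ha _ ⟨z, hz, rfl⟩)
      obtain ⟨q', hq', rfl⟩ := hQ hq
      exact ⟨q', hq, (edist_le_iff_sqDist_le hlam).2 hd⟩

/-! ### Sorting blocks of points by bottom-up merging -/

/-- The values of `X` increase within each block of length `W`. -/
def SortedBlocks (X : ℕ → ℝ) (n W : ℕ) : Prop :=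
  ∀ i j, i ≤ j → j < n → i / W = j / W → X i ≤ X j

/-- The families `(X j, Y j)` and `(X' j, Y' j)`, `j < n`, consist of the same points. -/
def SamePoints (X Y X' Y' : ℕ → ℝ) (n : ℕ) : Prop :=
  (∀ t < n, ∃ u < n, X' t = X u ∧ Y' t = Y u) ∧ ∀ u < n, ∃ t < n, X' t = X u ∧ Y' t = Y u

theorem SamePoints.trans {X Y X' Y' X'' Y'' : ℕ → ℝ} {n : ℕ} (h : SamePoints X Y X' Y' n)
    (h' : SamePoints X' Y' X'' Y'' n) : SamePoints X Y X'' Y'' n := by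
  constructor
  · intro t ht
    obtain ⟨u, hu, e₁, e₂⟩ := h'.1 t ht
    obtain ⟨v, hv, e₃, e₄⟩ := h.1 u hu
    exact ⟨v, hv, e₁.trans e₃, e₂.trans e₄⟩
  · intro t ht
    obtain ⟨u, hu, e₁, e₂⟩ := h.2 t ht
    obtain ⟨v, hv, e₃, e₄⟩ := h'.2 u hu
    exact ⟨v, hv, e₃.trans e₁, e₄.trans e₂⟩

theorem SamePoints.refl (X Y : ℕ → ℝ) (n : ℕ) : SamePoints X Y X Y n :=
  ⟨fun t ht => ⟨t, ht, rfl, rfl⟩, fun t ht => ⟨t, ht, rfl, rfl⟩⟩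

theorem front_congr_of_samePoints {X Y X' Y' : ℕ → ℝ} {n : ℕ} (h : SamePoints X Y X' Y' n) :
    front X' Y' n = front X Y n := by
  ext p
  constructor
  · rintro ⟨⟨j, hj, h₀, h₁⟩, hp⟩
    obtain ⟨u, hu, e₀, e₁⟩ := h.1 j hj
    refine ⟨⟨u, hu, e₀.symm.trans h₀, e₁.symm.trans h₁⟩, fun v hv => ?_⟩
    obtain ⟨t, ht, e₀, e₁⟩ := h.2 v hv
    rw [← e₀, ← e₁]
    exact hp t ht
  · rintro ⟨⟨j, hj, h₀, h₁⟩, hp⟩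
    obtain ⟨u, hu, e₀, e₁⟩ := h.2 j hj
    refine ⟨⟨u, hu, e₀.trans h₀, e₁.trans h₁⟩, fun v hv => ?_⟩
    obtain ⟨t, ht, e₀, e₁⟩ := h.1 v hv
    rw [e₀, e₁]
    exact hp t ht

theorem div_eq_of_dvd_of_lt {W b t : ℕ} (hb : W ∣ b) (h₁ : b ≤ t) (h₂ : t < b + W) :
    t / W = b / W := by
  obtain ⟨c, rfl⟩ := hb
  have hW : 0 < W := by omega
  rw [Nat.mul_div_cancel_left c hW, Nat.div_eq_iff hW]
  constructor <;> rw [mul_comm] <;> omega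

theorem le_of_dvd_of_div_eq {W b t : ℕ} (hb : W ∣ b) (h : t / W = b / W) : b ≤ t := by
  rw [← Nat.div_mul_cancel hb, ← h]
  exact Nat.div_mul_le_self t W

/-- The situation while blocks of length `W` are merged in pairs: the first `o` cells of the output
`(X', Y')` are filled, `[b, m)` and `[m, h)` are the blocks being merged, and `i` and `j` are their
first unused cells. -/
structure MergeInv (X Y X' Y' : ℕ → ℝ) (n W b o i j m h : ℕ) : Prop where
  dvd : 2 * W ∣ b
  le_i : b ≤ i
  i_le : i ≤ m
  m_le : m ≤ j
  j_le : j ≤ h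
  h_le : h ≤ n
  add_eq : i + j = o + m
  m_le_add : m ≤ b + W
  m_eq : m = h ∨ m = b + W
  h_le_add : h ≤ b + 2 * W
  h_dvd : h < n → 2 * W ∣ h
  source : ∀ t < o, ∃ u < n, X' t = X u ∧ Y' t = Y u
  used : ∀ u, u < i ∨ m ≤ u ∧ u < j → ∃ t < o, X' t = X u ∧ Y' t = Y u
  sorted : ∀ t t', t ≤ t' → t' < o → t / (2 * W) = t' / (2 * W) → X' t ≤ X' t'
  head : ∀ t, b ≤ t → t < o → (i < m → X' t ≤ X i) ∧ (j < h → X' t ≤ X j)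

namespace MergeInv

variable {X Y X' Y' : ℕ → ℝ} {n W b o i j m h : ℕ}

theorem init (X Y X' Y' : ℕ → ℝ) (n W : ℕ) : MergeInv X Y X' Y' n W 0 0 0 0 0 0 := by
  constructor <;> simp

/-- Only the last pair of blocks can be cut off at `n`, so a pair that ends before `n` ends at a
multiple of `2 * W`, where the next pair begins. -/
theorem reset (H : MergeInv X Y X' Y' n W b o i j m h) (ho : o = h) (hn : o < n) {m' h' : ℕ}
    (hm : m' = min (o + W) n) (hh : h' = min (m' + W) n) :
    MergeInv X Y X' Y' n W o o o m' m' h' := by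
  have h₁ := H.i_le
  have h₂ := H.j_le
  have h₃ := H.add_eq
  refine ⟨ho ▸ H.h_dvd (ho ▸ hn), le_rfl, by omega, le_rfl, by omega, by omega, rfl, by omega,
    by omega, by omega, fun hlt => ?_, H.source, fun u hu => H.used u (by omega), H.sorted,
    fun t h₁ h₂ => by omega⟩
  have : h' = o + 2 * W := by omega
  rw [this]
  exact (ho ▸ H.h_dvd (ho ▸ hn)).add (dvd_refl _)

/-- The clause `head` keeps the output sorted: what is written for this pair never exceeds the two
unused heads. It persists because `X u` is at most both heads and the input blocks increase. -/
theorem step (H : MergeInv X Y X' Y' n W b o i j m h) (hX : SortedBlocks X n W) {u i' j' : ℕ}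
    (hu : (u = i ∧ i < m ∧ i' = i + 1 ∧ j' = j) ∨ (u = j ∧ j < h ∧ i' = i ∧ j' = j + 1))
    (hi : i < m → X u ≤ X i) (hj : j < h → X u ≤ X j) :
    MergeInv X Y (Function.update X' o (X u)) (Function.update Y' o (Y u)) n W b (o + 1) i' j' m h
    := by
  obtain ⟨dvd, le_i, i_le, m_le, j_le, h_le, add_eq, m_le_add, m_eq, h_le_add, h_dvd, source, used,
    sorted, head⟩ := H
  have hW : W ∣ b := (Dvd.intro_left _ rfl).trans dvd
  have hne : ∀ t, t < o → t ≠ o := fun t => ne_of_lt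
  have hhead : ∀ t, b ≤ t → t < o → X' t ≤ X u := fun t h₁ h₂ => by
    rcases hu with ⟨rfl, hlt, -⟩ | ⟨rfl, hlt, -⟩
    exacts [(head t h₁ h₂).1 hlt, (head t h₁ h₂).2 hlt]
  have hi' : i' < m → X u ≤ X i' := fun hlt => by
    rcases hu with ⟨rfl, hlt', rfl, rfl⟩ | ⟨rfl, hlt', rfl, rfl⟩
    · refine hX _ _ (by omega) (by omega) ?_
      exact (div_eq_of_dvd_of_lt hW (by omega) (by omega)).trans
        (div_eq_of_dvd_of_lt hW (by omega) (by omega)).symm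
    · exact hi hlt
  have hj' : j' < h → X u ≤ X j' := fun hlt => by
    rcases hu with ⟨rfl, hlt', rfl, rfl⟩ | ⟨rfl, hlt', rfl, rfl⟩
    · exact hj hlt
    -- From `m ≤ j < h` the second block is non-empty, so the first one is complete and the second
    -- one starts at a multiple of `W`.
    · have hm : m = b + W := by omega
      have hW' : W ∣ m := hm ▸ hW.add (dvd_refl _)
      refine hX _ _ (by omega) (by omega) ?_
      exact (div_eq_of_dvd_of_lt hW' (by omega) (by omega)).trans
        (div_eq_of_dvd_of_lt hW' (by omega) (by omega)).symm
  refine ⟨dvd, by omega, by omega, by omega, by omega, h_le, by omega, m_le_add, m_eq, h_le_add,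
    h_dvd, fun t ht => ?_, fun v hv => ?_, fun t t' htt ht' hdiv => ?_, fun t hbt ht => ?_⟩
  · rcases Nat.lt_succ_iff_lt_or_eq.1 ht with ht | rfl
    · simpa [Function.update_of_ne (hne t ht)] using source t ht
    · exact ⟨u, by omega, by simp⟩
  · by_cases hvu : v = u
    · subst hvu
      exact ⟨o, by omega, by simp⟩
    · obtain ⟨t, ht, e⟩ := used v (by omega)
      exact ⟨t, by omega, by simpa [Function.update_of_ne (hne t ht)] using e⟩
  · rcases Nat.lt_succ_iff_lt_or_eq.1 ht' with ht' | rfl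
    · rw [Function.update_of_ne (hne t (by omega)), Function.update_of_ne (hne t' ht')]
      exact sorted t t' htt ht' hdiv
    · rcases htt.lt_or_eq with htt | rfl
      · rw [Function.update_of_ne (hne t htt), Function.update_self]
        refine hhead t (le_of_dvd_of_div_eq dvd ?_) htt
        rw [hdiv, div_eq_of_dvd_of_lt dvd (by omega) (by omega)]
      · rfl
  · rcases Nat.lt_succ_iff_lt_or_eq.1 ht with ht | rfl
    · rw [Function.update_of_ne (hne t ht)]
      exact ⟨fun hlt => (hhead t hbt ht).trans (hi' hlt),
        fun hlt => (hhead t hbt ht).trans (hj' hlt)⟩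
    · rw [Function.update_self]
      exact ⟨hi', hj'⟩

theorem finish (H : MergeInv X Y X' Y' n W b n i j m h) :
    SamePoints X Y X' Y' n ∧ SortedBlocks X' n (2 * W) := by
  have := H.i_le
  have := H.j_le
  have := H.h_le
  have := H.m_le
  have := H.add_eq
  -- The count `i + j = n + m` with `i ≤ m` and `j ≤ h ≤ n` forces `i = m` and `j = n`, so every
  -- index has been used.
  exact ⟨⟨H.source, fun u hu => H.used u (by omega)⟩, H.sorted⟩

end MergeInv

/-! ### Programs for merging and sorting the blocks -/

namespace RealRAM

/-- Start merging the next pair of blocks. -/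
def mergeReset : Program :=
  .seq (.wset 7 (.reg 6)) <|
  .seq (.wset 9 (.sub (.add (.reg 6) (.reg 2)) (.sub (.add (.reg 6) (.reg 2)) (.reg 0)))) <|
  .seq (.wset 8 (.reg 9)) <|
  .wset 10 (.sub (.add (.reg 9) (.reg 2)) (.sub (.add (.reg 9) (.reg 2)) (.reg 0)))

/-- Copy the point whose index is in word register `v` to the output, and advance. -/
def mergeTake (v : ℕ) : Program :=
  .seq (.rstore 2 (.reg 6) (.read 0 (.reg v))) <|
  .seq (.rstore 3 (.reg 6) (.read 1 (.reg v))) <|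
  .seq (.wset v (.add (.reg v) (.const 1))) <|
  .wset 6 (.add (.reg 6) (.const 1))

/-- Write one point of the output of the merge. -/
def mergeStep : Program :=
  .seq (.branch (.wlt (.reg 6) (.reg 10)) .skip mergeReset) <|
  .branch (.and (.wlt (.reg 7) (.reg 9))
      (.or (.not (.wlt (.reg 8) (.reg 10))) (.not (.rlt (.read 0 (.reg 8)) (.read 0 (.reg 7))))))
    (mergeTake 7) (mergeTake 8)

/-- Copy one point back. -/
def copyStep : Program :=
  .seq (.rstore 0 (.reg 6) (.read 2 (.reg 6))) <|
  .seq (.rstore 1 (.reg 6) (.read 3 (.reg 6))) <|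
  .wset 6 (.add (.reg 6) (.const 1))

/-- Initialization of a merge pass. -/
def mergeInit : Program :=
  .seq (.wset 6 (.const 0)) <|
  .seq (.wset 7 (.const 0)) <|
  .seq (.wset 8 (.const 0)) <|
  .seq (.wset 9 (.const 0)) <|
  .wset 10 (.const 0)

/-- Merge the sorted blocks of length `W` (word register `2`) of the points in pairs. -/
def mergePass : Program :=
  .seq mergeInit <|
  .seq (.loop (.wlt (.reg 6) (.reg 0)) mergeStep) <|
  .seq (.wset 6 (.const 0)) <|
  .seq (.loop (.wlt (.reg 6) (.reg 0)) copyStep) <|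
  .wset 2 (.add (.reg 2) (.reg 2))

/-- `MergeInv` for the memory contents of `s`. -/
def MergeState (X Y : ℕ → ℝ) (n W : ℕ) (s : State) : Prop :=
  ∃ b, MergeInv X Y (s.rarr 2) (s.rarr 3) n W b (s.wreg 6) (s.wreg 7) (s.wreg 8) (s.wreg 9)
    (s.wreg 10)

theorem wp_mergeTake {w n W : ℕ} {X Y : ℕ → ℝ} {s : State} (hw : n + 1 < 2 ^ w) {b : ℕ}
    (hX₀ : s.rarr 0 = X) (hY₀ : s.rarr 1 = Y) (hX : SortedBlocks X n W)
    (H : MergeInv X Y (s.rarr 2) (s.rarr 3) n W b (s.wreg 6) (s.wreg 7) (s.wreg 8) (s.wreg 9)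
      (s.wreg 10)) {v : ℕ} (ho : s.wreg 6 < n)
    (hv : v = 7 ∧ s.wreg 7 < s.wreg 9 ∨ v = 8 ∧ s.wreg 8 < s.wreg 10)
    (hi : s.wreg 7 < s.wreg 9 → X (s.wreg v) ≤ X (s.wreg 7))
    (hj : s.wreg 8 < s.wreg 10 → X (s.wreg v) ≤ X (s.wreg 8)) :
    (mergeTake v).wp w (fun s' => MergeState X Y n W s' ∧ n - s'.wreg 6 < n - s.wreg 6) s := by
  have h₁ : 1 % 2 ^ w = 1 := Nat.mod_eq_of_lt (by omega)
  have h₂ : (s.wreg 6 + 1) % 2 ^ w = s.wreg 6 + 1 := Nat.mod_eq_of_lt (by omega)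
  have := H.i_le
  have := H.m_le
  have := H.j_le
  have := H.h_le
  rcases hv with ⟨rfl, hv⟩ | ⟨rfl, hv⟩
  · have h₃ : (s.wreg 7 + 1) % 2 ^ w = s.wreg 7 + 1 := Nat.mod_eq_of_lt (by omega)
    have := H.step hX (u := s.wreg 7) (.inl ⟨rfl, hv, rfl, rfl⟩) hi hj
    simp only [mergeTake, Program.wp, WExp.eval, RExp.eval, MergeState]
    simp [h₁, h₂, h₃, hX₀, hY₀]
    exact ⟨⟨b, this⟩, by omega⟩
  · have h₃ : (s.wreg 8 + 1) % 2 ^ w = s.wreg 8 + 1 := Nat.mod_eq_of_lt (by omega)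
    have := H.step hX (u := s.wreg 8) (.inr ⟨rfl, hv, rfl, rfl⟩) hi hj
    simp only [mergeTake, Program.wp, WExp.eval, RExp.eval, MergeState]
    simp [h₁, h₂, h₃, hX₀, hY₀]
    exact ⟨⟨b, this⟩, by omega⟩

theorem wp_mergeStep {w n W : ℕ} {X Y : ℕ → ℝ} {s : State} (hw : n + W + 1 < 2 ^ w) (hW : 0 < W)
    (hn : s.wreg 0 = n) (hWs : s.wreg 2 = W) (hX₀ : s.rarr 0 = X) (hY₀ : s.rarr 1 = Y)
    (hX : SortedBlocks X n W) (H : MergeState X Y n W s) (ho : s.wreg 6 < n) :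
    mergeStep.wp w (fun s' => MergeState X Y n W s' ∧ n - s'.wreg 6 < n - s.wreg 6) s := by
  -- After the possible reset, `o < h`. Since `i + j = o + m`, at least one of the two blocks then
  -- has an unused point.
  suffices h : (Program.branch (.wlt (.reg 6) (.reg 10)) .skip mergeReset).wp w
      (fun s' => (MergeState X Y n W s' ∧ s'.wreg 6 < s'.wreg 10) ∧
        s'.wreg 6 = s.wreg 6 ∧ s'.rarr 0 = X ∧ s'.rarr 1 = Y) s by
    change (Program.branch (.wlt (.reg 6) (.reg 10)) .skip mergeReset).wp w _ s
    refine Program.wp_mono h ?_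
    rintro s' ⟨⟨⟨b, H⟩, hlt⟩, h₆, hX₀, hY₀⟩
    have := H.add_eq
    have := H.m_le
    have := H.i_le
    have := H.j_le
    rw [← h₆] at ho ⊢
    constructor
    · rintro ⟨hv, h⟩
      refine wp_mergeTake (by omega) hX₀ hY₀ hX H ho (.inl ⟨rfl, hv⟩) (fun _ => le_rfl) fun hj => ?_
      simp only [BExp.Holds, WExp.eval, RExp.eval, hX₀, not_lt] at h
      exact h.resolve_left (by omega)
    · intro h
      simp only [BExp.Holds, WExp.eval, RExp.eval, hX₀, not_and_or, not_or, not_lt, not_le] at h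
      refine wp_mergeTake (by omega) hX₀ hY₀ hX H ho (.inr ⟨rfl, ?_⟩) (fun hi => ?_) fun _ => le_rfl
      · rcases h with h | h
        · omega
        · exact h.1
      · exact (h.resolve_left (by omega)).2.le
  obtain ⟨b, H⟩ := H
  constructor
  · intro h
    exact ⟨⟨⟨b, H⟩, h⟩, rfl, hX₀, hY₀⟩
  · intro h
    simp only [BExp.Holds, WExp.eval, not_lt] at h
    have h₁ := H.add_eq
    have h₂ := H.m_le
    have h₃ := H.i_le
    have h₄ := H.j_le
    have := H.reset (by omega) ho rfl rfl
    have e₁ : (s.wreg 6 + W) % 2 ^ w = s.wreg 6 + W := Nat.mod_eq_of_lt (by omega)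
    have e₂ : (min (s.wreg 6 + W) n + W) % 2 ^ w = min (s.wreg 6 + W) n + W :=
      Nat.mod_eq_of_lt (by omega)
    -- The program computes minima by truncated subtraction.
    have e₃ : ∀ a, a - (a - n) = min a n := by omega
    simp only [mergeReset, Program.wp, WExp.eval, MergeState]
    simp [hn, hWs, e₁, e₂, e₃, hX₀, hY₀]
    exact ⟨⟨_, this⟩, by omega⟩

theorem exec_mergePass {w n W : ℕ} {s : State} (hw : n + 2 * W + 1 < 2 ^ w) (hW : 0 < W)
    (hn : s.wreg 0 = n) (hWs : s.wreg 2 = W) (hX : SortedBlocks (s.rarr 0) n W) :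
    ∃ t s', Exec w mergePass s t s' ∧ t ≤ (mergeStep.bound + copyStep.bound + 50) * (n + 1) ∧
      SamePoints (s.rarr 0) (s.rarr 1) (s'.rarr 0) (s'.rarr 1) n ∧
      SortedBlocks (s'.rarr 0) n (2 * W) ∧ s'.wreg 2 = 2 * W := by
  obtain ⟨t₁, s₁, e₁, ht₁, h₆, h₇, h₈, h₉, h₁₀⟩ := mergeInit.exec_of_wp (w := w) (s := s)
    (Q := fun s' => s'.wreg 6 = 0 ∧ s'.wreg 7 = 0 ∧ s'.wreg 8 = 0 ∧ s'.wreg 9 = 0 ∧ s'.wreg 10 = 0)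
    (by simp [mergeInit, Program.wp, WExp.eval])
  have f₁ := e₁.frame
  obtain ⟨t₂, s₂, e₂, f₂, H₂, h₂, ht₂⟩ := exec_loop_of_wp (w := w) (b := .wlt (.reg 6) (.reg 0))
    (c := mergeStep) (MergeState (s.rarr 0) (s.rarr 1) n W) (fun s' => n - s'.wreg 6) (s₀ := s₁)
    -- All indices start at `0`, as if an empty pair had just been merged, so the first step
    -- performs a reset.
    ⟨0, by rw [h₆, h₇, h₈, h₉, h₁₀]; exact .init _ _ _ _ _ _⟩ fun s' f' H hb => by
      have f := (f₁.wreg 0 rfl).trans hn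
      refine wp_mergeStep (by omega) hW ((f'.wreg 0 rfl).trans f)
        ((f'.wreg 2 rfl).trans ((f₁.wreg 2 rfl).trans hWs)) ((f'.rarr 0 rfl).trans (f₁.rarr 0 rfl))
        ((f'.rarr 1 rfl).trans (f₁.rarr 1 rfl)) hX H ?_
      rw [← f, ← f'.wreg 0 rfl]
      exact hb
  have hn₂ : s₂.wreg 0 = n := (f₂.wreg 0 rfl).trans ((f₁.wreg 0 rfl).trans hn)
  obtain ⟨b, H₂⟩ := H₂
  have ho : s₂.wreg 6 = n := by
    simp only [BExp.Holds, WExp.eval, hn₂] at h₂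
    have := H₂.i_le
    have := H₂.j_le
    have := H₂.h_le
    have := H₂.add_eq
    omega
  rw [ho] at H₂
  obtain ⟨hsame, hsorted⟩ := H₂.finish
  have e₃ := Exec.wset (w := w) 6 (.const 0) s₂
  set s₃ : State := { s₂ with wreg := Function.update s₂.wreg 6 (WExp.eval w s₂ (.const 0)) }
    with hs₃
  obtain ⟨t₄, s₄, e₄, f₄, H₄, h₄, ht₄⟩ := exec_loop_of_wp (w := w) (b := .wlt (.reg 6) (.reg 0))
    (c := copyStep)
    (fun s' => ∀ t < s'.wreg 6, s'.rarr 0 t = s₂.rarr 2 t ∧ s'.rarr 1 t = s₂.rarr 3 t)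
    (fun s' => n - s'.wreg 6) (s₀ := s₃)
    (by simp [hs₃, WExp.eval]) fun s' f' H hb => by
      have f : s'.wreg 0 = n := (f'.wreg 0 rfl).trans hn₂
      have f₂ : s'.rarr 2 = s₂.rarr 2 := f'.rarr 2 rfl
      have f₃ : s'.rarr 3 = s₂.rarr 3 := f'.rarr 3 rfl
      simp only [BExp.Holds, WExp.eval, f] at hb
      have h₁ : 1 % 2 ^ w = 1 := Nat.mod_eq_of_lt (by omega)
      have h₂ : (s'.wreg 6 + 1) % 2 ^ w = s'.wreg 6 + 1 := Nat.mod_eq_of_lt (by omega)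
      simp only [copyStep, Program.wp, WExp.eval, RExp.eval]
      simp [h₁, h₂, f₂, f₃]
      refine ⟨fun t ht => ?_, by omega⟩
      rcases ht.lt_or_eq with ht | rfl
      · simpa [Function.update_of_ne ht.ne] using H t ht
      · simp
  have hn₄ : s₄.wreg 0 = n := (f₄.wreg 0 rfl).trans hn₂
  simp only [BExp.Holds, WExp.eval, hn₄, not_lt] at h₄
  have hcopy : ∀ t < n, s₄.rarr 0 t = s₂.rarr 2 t ∧ s₄.rarr 1 t = s₂.rarr 3 t :=
    fun t ht => H₄ t (by omega)
  have hW₄ : s₄.wreg 2 = W :=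
    (f₄.wreg 2 rfl).trans ((f₂.wreg 2 rfl).trans ((f₁.wreg 2 rfl).trans hWs))
  refine ⟨_, _, .seq e₁ (.seq e₂ (.seq e₃ (.seq e₄ (.wset 2 _ s₄)))), ?_, ⟨?_, ?_⟩, ?_, ?_⟩
  · have hb₁ : mergeInit.bound = 10 := rfl
    have hb₂ : (BExp.wlt (.reg 6) (.reg 0)).cost = 3 := rfl
    have hb₃ : (WExp.const 0).cost = 1 := rfl
    have hb₄ : (WExp.add (.reg 2) (.reg 2)).cost = 3 := rfl
    have hs₆ : n - s₃.wreg 6 ≤ n := Nat.sub_le _ _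
    have hs₆' := Nat.mul_le_mul_left (3 + copyStep.bound + 1) (Nat.add_le_add_right hs₆ 1)
    rw [hb₂, h₆] at ht₂
    rw [hb₂] at ht₄
    rw [hb₃, hb₄]
    generalize mergeStep.bound = x at *
    generalize copyStep.bound = y at *
    have h₂ : t₂ ≤ (3 + x + 1) * (n + 1) := le_trans (Nat.le_add_right _ _) ht₂
    have h₄ : t₄ ≤ (3 + y + 1) * (n + 1) := le_trans (Nat.le_add_right _ _) (ht₄.trans hs₆')
    have : (x + y + 50) * (n + 1) =
        (3 + x + 1) * (n + 1) + (3 + y + 1) * (n + 1) + 42 * (n + 1) := by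
      ring
    omega
  · intro t ht
    rw [show _ = s₄.rarr 0 t from rfl, show _ = s₄.rarr 1 t from rfl,
      (hcopy t ht).1, (hcopy t ht).2]
    exact hsame.1 t ht
  · intro u hu
    obtain ⟨t, ht, e, e'⟩ := hsame.2 u hu
    exact ⟨t, ht, (hcopy t ht).1.trans e, (hcopy t ht).2.trans e'⟩
  · intro i j hij hj hdiv
    exact ((hcopy i (by omega)).1.trans_le (hsorted i j hij hj hdiv)).trans_eq (hcopy j hj).1.symm
  · have : (W + W) % 2 ^ w = W + W := Nat.mod_eq_of_lt (by omega)
    simp [WExp.eval, hW₄, this]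
    omega

/-- Choose `min k n` as the number of centres, and sort blocks of at least that length. -/
def sortBlocks : Program :=
  .seq (.branch (.wlt (.reg 0) (.reg 1)) (.wset 1 (.reg 0)) .skip) <|
  .seq (.wset 2 (.const 1)) <|
  .loop (.wlt (.reg 2) (.reg 1)) mergePass

theorem exec_sortBlocks {w n k : ℕ} {s : State} (hw : 5 * n + 1 < 2 ^ w) (hn₀ : 0 < n)
    (hn : s.wreg 0 = n) (hk : s.wreg 1 = k) :
    ∃ t s' W, Exec w sortBlocks s t s' ∧
      t ≤ ((mergeStep.bound + copyStep.bound + 50) * (n + 1) + 4) * (Nat.clog 2 (min k n) + 3) ∧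
      s'.wreg 2 = W ∧ s'.wreg 1 = min k n ∧ 0 < W ∧ W ≤ 2 * n ∧ min k n ≤ W ∧
      SamePoints (s.rarr 0) (s.rarr 1) (s'.rarr 0) (s'.rarr 1) n ∧
      SortedBlocks (s'.rarr 0) n W := by
  obtain ⟨t₁, s₁, e₁, ht₁, h₁⟩ := (Program.seq
    (.branch (.wlt (.reg 0) (.reg 1)) (.wset 1 (.reg 0)) .skip) (.wset 2 (.const 1))).exec_of_wp
    (w := w) (s := s) (Q := fun s' => s'.wreg 2 = 1 ∧ s'.wreg 1 = min k n) (by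
      have h₁ : 1 % 2 ^ w = 1 := Nat.mod_eq_of_lt (by omega)
      simp only [Program.wp, WExp.eval, BExp.Holds]
      simp [h₁, hn, hk]
      omega)
  have f₁ := e₁.frame
  set T := (mergeStep.bound + copyStep.bound + 50) * (n + 1) with hT
  obtain ⟨t₂, s₂, e₂, f₂, ⟨m, hm, hmk, hsame, hsort⟩, h₂, ht₂⟩ := exec_loop (w := w)
    (b := .wlt (.reg 2) (.reg 1)) (c := mergePass) (s₀ := s₁)
    -- The length is doubled only while it is below `min k n ≤ n`, hence the bound `2 * n`. As it is
    -- a power of two, `Nat.log 2` recovers its exponent, which rises by one per pass and stops at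
    -- `Nat.clog 2 (min k n)`. The `4` in the potential pays for the loop test.
    (fun s' => ∃ m, s'.wreg 2 = 2 ^ m ∧ 2 ^ m ≤ 2 * n ∧
      SamePoints (s.rarr 0) (s.rarr 1) (s'.rarr 0) (s'.rarr 1) n ∧
      SortedBlocks (s'.rarr 0) n (2 ^ m))
    (fun s' => (T + 4) * (Nat.clog 2 (min k n) - Nat.log 2 (s'.wreg 2)))
    (by
      refine ⟨0, h₁.1, by omega, ?_, ?_⟩
      · rw [f₁.rarr 0 rfl, f₁.rarr 1 rfl]
        exact .refl _ _ _
      · intro i j _ _ hij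
        rw [pow_zero, Nat.div_one, Nat.div_one] at hij
        rw [hij])
    fun s' f' ⟨m, hm, hmk, hsame, hsort⟩ hb => by
      have hn' : s'.wreg 0 = n := (f'.wreg 0 rfl).trans ((f₁.wreg 0 rfl).trans hn)
      have hk' : s'.wreg 1 = min k n := (f'.wreg 1 rfl).trans h₁.2
      simp only [BExp.Holds, WExp.eval, hm, hk'] at hb
      obtain ⟨t, s'', e, ht, hsame', hsort', hW⟩ := exec_mergePass (w := w) (W := 2 ^ m)
        (by omega) (by positivity) hn' hm hsort
      refine ⟨t, s'', e, ⟨m + 1, by rw [hW, pow_succ'], by rw [pow_succ']; omega,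
        hsame.trans hsame', by rwa [pow_succ']⟩, ?_⟩
      have hlt : m < Nat.clog 2 (min k n) := (Nat.lt_clog_iff_pow_lt (by norm_num)).2 hb
      rw [hW, hm, ← pow_succ', Nat.log_pow (by norm_num), Nat.log_pow (by norm_num)]
      obtain ⟨d, hd⟩ := Nat.exists_eq_add_of_lt hlt
      rw [hd, show m + d + 1 - (m + 1) = d by omega, show m + d + 1 - m = d + 1 by omega,
        mul_add, mul_one]
      have hc : (BExp.wlt (.reg 2) (.reg 1)).cost = 3 := rfl
      omega
  have hk₂ : s₂.wreg 1 = min k n := (f₂.wreg 1 rfl).trans h₁.2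
  simp only [BExp.Holds, WExp.eval, hk₂, hm, not_lt] at h₂
  cases e₁ with
  | seq a b =>
    refine ⟨_, s₂, 2 ^ m, .seq a (.seq b e₂), ?_, hm, hk₂, by positivity, hmk, h₂, hsame, hsort⟩
    have hc : (BExp.wlt (.reg 2) (.reg 1)).cost = 3 := rfl
    have hc' : (Program.seq
      (.branch (.wlt (.reg 0) (.reg 1)) (.wset 1 (.reg 0)) .skip) (.wset 2 (.const 1))).bound = 9 :=
      rfl
    have hle : (T + 4) * (Nat.clog 2 (min k n) - Nat.log 2 (s₁.wreg 2)) ≤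
        (T + 4) * Nat.clog 2 (min k n) := Nat.mul_le_mul_left _ (Nat.sub_le _ _)
    rw [mul_add]
    have : 50 * 1 ≤ T := Nat.mul_le_mul (by omega) (by omega)
    omega

end RealRAM

/-! ### The staircases of the blocks -/

/-- `q` is higher than `p`, or as high and not further to the left. -/
def HighLe (p q : ℝ × ℝ) : Prop := p.2 < q.2 ∨ p.2 = q.2 ∧ p.1 ≤ q.1

theorem HighLe.trans {p q r : ℝ × ℝ} (h : HighLe p q) (h' : HighLe q r) : HighLe p r := by
  rcases h with h | h <;> rcases h' with h' | h'
  · exact .inl (h.trans h')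
  · exact .inl (h.trans_eq h'.1)
  · exact .inl (h.1.trans_lt h')
  · exact .inr ⟨h.1.trans h'.1, h.2.trans h'.2⟩

/-- In each block of length `W` the points descend to the right. -/
def StairBlocks (X Y : ℕ → ℝ) (n W : ℕ) : Prop :=
  ∀ i j, i ≤ j → j < n → i / W = j / W →
    X i ≤ X j ∧ (Y j < Y i ∨ (X i = X j ∧ Y i = Y j))

/-- The situation while the points of the blocks of `(X, Y)` are replaced, from the right to the
left, by the highest points further to the right in their blocks. -/
structure StairInv (X Y X' Y' : ℕ → ℝ) (n W j : ℕ) : Prop where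
  rest : ∀ t < j, X' t = X t ∧ Y' t = Y t
  source : ∀ t, j ≤ t → t < n → ∃ u < n, t ≤ u ∧ u / W = t / W ∧ X' t = X u ∧ Y' t = Y u
  chain : ∀ t t', j ≤ t → t ≤ t' → t' < n → t / W = t' / W →
    X' t ≤ X' t' ∧ (Y' t' < Y' t ∨ (X' t = X' t' ∧ Y' t = Y' t'))
  le : ∀ t, j ≤ t → t < n → X t ≤ X' t ∧ Y t ≤ Y' t

namespace StairInv

variable {X Y X' Y' : ℕ → ℝ} {n W i : ℕ}

theorem init (X Y : ℕ → ℝ) {n W j : ℕ} (hj : n ≤ j + 1) : StairInv X Y X Y n W j := by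
  refine ⟨fun _ _ => ⟨rfl, rfl⟩, fun t _ ht => ⟨t, ht, le_rfl, rfl, rfl, rfl⟩, ?_,
    fun _ _ _ => ⟨le_rfl, le_rfl⟩⟩
  intro t t' h₁ h₂ h₃ _
  obtain rfl : t = t' := by omega
  exact ⟨le_rfl, .inr ⟨rfl, rfl⟩⟩

/-- By `chain`, cell `i + 1` holds a highest point of the rest of its block, so a point above it is
above all of them. The abscissae compare because `source` traces each cell to an original index
further to the right. -/
theorem keep (H : StairInv X Y X' Y' n W (i + 1)) (hX : SortedBlocks X n W)
    (h : i / W = (i + 1) / W → Y' (i + 1) < Y' i) : StairInv X Y X' Y' n W i := by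
  obtain ⟨rest, source, chain, le⟩ := H
  have hi := rest i (by omega)
  refine ⟨fun t ht => rest t (by omega), fun t ht htn => ?_, fun t t' ht htt htn hdiv => ?_,
    fun t ht htn => ?_⟩
  · rcases ht.lt_or_eq with ht | rfl
    · exact source t ht htn
    · exact ⟨i, htn, le_rfl, rfl, hi⟩
  · rcases ht.lt_or_eq with ht | rfl
    · exact chain t t' ht htt htn hdiv
    · rcases htt.lt_or_eq with htt | rfl
      · have h₁ : i / W ≤ (i + 1) / W := Nat.div_le_div_right (by omega)
        have h₂ : (i + 1) / W ≤ t' / W := Nat.div_le_div_right (by omega)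
        have h₃ := h (by omega)
        obtain ⟨u, hun, htu, hu, e, -⟩ := source t' (by omega) htn
        obtain ⟨-, h₄⟩ := chain (i + 1) t' le_rfl htt htn (by omega)
        refine ⟨?_, .inl ?_⟩
        · rw [hi.1, e]
          exact hX i u (by omega) hun (by omega)
        · rcases h₄ with h₄ | h₄ <;> linarith
      · exact ⟨le_rfl, .inr ⟨rfl, rfl⟩⟩
  · rcases ht.lt_or_eq with ht | rfl
    · exact le t ht htn
    · exact ⟨hi.1.ge, hi.2.ge⟩

/-- The overwritten point is weakly dominated by the copied one: that one is not lower, and it stems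
from a later index of a block sorted by abscissa. -/
theorem copy (H : StairInv X Y X' Y' n W (i + 1)) (hX : SortedBlocks X n W) (hin : i + 1 < n)
    (h : i / W = (i + 1) / W) (hY : Y' i ≤ Y' (i + 1)) :
    StairInv X Y (Function.update X' i (X' (i + 1))) (Function.update Y' i (Y' (i + 1))) n W i := by
  obtain ⟨rest, source, chain, le⟩ := H
  have hi := rest i (by omega)
  obtain ⟨u, hun, hiu, hu, e₁, e₂⟩ := source (i + 1) le_rfl hin
  refine ⟨fun t ht => ?_, fun t ht htn => ?_, fun t t' ht htt htn hdiv => ?_, fun t ht htn => ?_⟩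
  · simpa [Function.update_of_ne ht.ne] using rest t (by omega)
  · rcases ht.lt_or_eq with ht | rfl
    · simpa [Function.update_of_ne ht.ne'] using source t ht htn
    · exact ⟨u, hun, by omega, by omega, by simpa using ⟨e₁, e₂⟩⟩
  · rcases ht.lt_or_eq with ht | rfl
    · have ht' : i < t' := by omega
      simpa [Function.update_of_ne ht.ne', Function.update_of_ne ht'.ne'] using
        chain t t' ht htt htn hdiv
    · rcases htt.lt_or_eq with htt | rfl
      · simpa [Function.update_of_ne htt.ne'] using chain (i + 1) t' le_rfl htt htn (by omega)
      · exact ⟨le_rfl, .inr ⟨rfl, rfl⟩⟩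
  · rcases ht.lt_or_eq with ht | rfl
    · simpa [Function.update_of_ne ht.ne'] using le t ht htn
    · simp only [Function.update_self]
      refine ⟨?_, hi.2 ▸ hY⟩
      rw [e₁]
      exact hX i u (by omega) hun (by omega)

/-- Every new point is an old one, and every old point is weakly dominated by the new point at its
index. Such a replacement does not change the maximal points. -/
theorem front_eq (H : StairInv X Y X' Y' n W 0) : front X' Y' n = front X Y n := by
  obtain ⟨-, source, -, le⟩ := H
  ext p
  constructor
  · rintro ⟨⟨j, hj, h₀, h₁⟩, hp⟩
    obtain ⟨u, hu, -, -, e₁, e₂⟩ := source j (by omega) hj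
    refine ⟨⟨u, hu, e₁.symm.trans h₀, e₂.symm.trans h₁⟩, fun t ht => ?_⟩
    have h := le t (by omega) ht
    rcases hp t ht with h' | h' | h'
    · exact .inl (h.1.trans_lt h')
    · exact .inr (.inl (h.2.trans_lt h'))
    · rw [h'.1, h'.2] at h
      rcases h.1.lt_or_eq with h₁ | h₁
      · exact .inl h₁
      · rcases h.2.lt_or_eq with h₂ | h₂
        exacts [.inr (.inl h₂), .inr (.inr ⟨h₁, h₂⟩)]
  · rintro ⟨⟨j, hj, h₀, h₁⟩, hp⟩
    obtain ⟨u, hu, -, -, e₁, e₂⟩ := source j (by omega) hj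
    have h := le j (by omega) hj
    have h' := hp u hu
    rw [e₁, e₂, h₀, h₁] at h
    refine ⟨⟨j, hj, ?_⟩, fun t ht => ?_⟩
    · rw [e₁, e₂]
      rcases h' with h' | h' | h'
      · linarith
      · linarith
      · exact h'
    · obtain ⟨v, hv, -, -, e₃, e₄⟩ := source t (by omega) ht
      rw [e₃, e₄]
      exact hp v hv

end StairInv

/-- `f` is a highest one, of these a rightmost one, among the points from index `j` on. -/
def Highest (X Y : ℕ → ℝ) (n j : ℕ) (f : ℝ × ℝ) : Prop :=
  (∃ u < n, j ≤ u ∧ X u = f.1 ∧ Y u = f.2) ∧ ∀ t, j ≤ t → t < n → HighLe (X t, Y t) f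

theorem Highest.mem_front {X Y : ℕ → ℝ} {n : ℕ} {f : ℝ × ℝ} (h : Highest X Y n 0 f) :
    f ∈ front X Y n := by
  obtain ⟨⟨u, hu, -, e⟩, h⟩ := h
  refine ⟨⟨u, hu, e⟩, fun j hj => ?_⟩
  rcases h j (by omega) hj with h | ⟨h, h'⟩
  · exact .inr (.inl h)
  · rcases h'.lt_or_eq with h' | h'
    exacts [.inl h', .inr (.inr ⟨h', h⟩)]

/-- A skyline point strictly to the left of `f` would have to be higher than `f`. Hence `f` is where
the greedy algorithm starts. -/
theorem Highest.le {X Y : ℕ → ℝ} {n : ℕ} {f : ℝ × ℝ} (h : Highest X Y n 0 f) :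
    ∀ z ∈ front X Y n, f.1 ≤ z.1 := by
  rintro z ⟨⟨j, hj, e₁, e₂⟩, hz⟩
  obtain ⟨⟨u, hu, -, e₃, e₄⟩, hf⟩ := h
  have h₁ := hf j (by omega) hj
  have h₂ := hz u hu
  rw [e₃, e₄] at h₂
  rw [e₁, e₂] at h₁
  rcases h₂ with h₂ | h₂ | h₂
  · exact h₂.le
  · rcases h₁ with h₁ | h₁ <;> dsimp only at h₁ <;> linarith
  · exact h₂.1.le

namespace RealRAM

/-- Replace a point by its right neighbour if that is in the same block and not lower. -/
def stairCopy : Program :=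
  .branch (.and
      (.not (.wlt (.div (.reg 6) (.reg 2)) (.div (.add (.reg 6) (.const 1)) (.reg 2))))
      (.not (.rlt (.read 1 (.add (.reg 6) (.const 1))) (.read 1 (.reg 6)))))
    (.seq (.rstore 0 (.reg 6) (.read 0 (.add (.reg 6) (.const 1))))
      (.rstore 1 (.reg 6) (.read 1 (.add (.reg 6) (.const 1)))))
    .skip

/-- Is the point whose index is in word register `6` higher than the point in the real registers
`4`, `5`, or as high and further to the right? -/
def isHigher : BExp :=
  .or (.rlt (.reg 5) (.read 1 (.reg 6)))
    (.and (.not (.rlt (.read 1 (.reg 6)) (.reg 5))) (.rlt (.reg 4) (.read 0 (.reg 6))))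

/-- Load the point whose index is in word register `6` into the real registers `4`, `5`. -/
def loadPoint : Program :=
  .seq (.rset 4 (.read 0 (.reg 6))) (.rset 5 (.read 1 (.reg 6)))

/-- Treat the next point to the left, and update the highest point. -/
def stairStep : Program :=
  .seq (.wset 6 (.sub (.reg 6) (.const 1))) <|
  .seq stairCopy <|
  .branch isHigher loadPoint .skip

/-- Compute the staircases of the blocks, and the highest point. -/
def stairs : Program :=
  .seq (.seq (.wset 6 (.sub (.reg 0) (.const 1))) loadPoint) <|
  .loop (.wlt (.const 0) (.reg 6)) stairStep

theorem not_isHigher {w : ℕ} {s : State} (h : ¬ isHigher.Holds w s) :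
    HighLe (s.rarr 0 (s.wreg 6), s.rarr 1 (s.wreg 6)) (s.rreg 4, s.rreg 5) := by
  simp only [isHigher, BExp.Holds, WExp.eval, RExp.eval, not_or, not_and, not_lt] at h
  rcases h.1.lt_or_eq with h' | h'
  · exact .inl h'
  · exact .inr ⟨h', h.2 h'.ge⟩

theorem highLe_of_isHigher {w : ℕ} {s : State} (h : isHigher.Holds w s) :
    HighLe (s.rreg 4, s.rreg 5) (s.rarr 0 (s.wreg 6), s.rarr 1 (s.wreg 6)) := by
  simp only [isHigher, BExp.Holds, WExp.eval, RExp.eval, not_lt] at h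
  rcases h with h | ⟨h, h'⟩
  · exact .inl h
  · rcases h.lt_or_eq with h | h
    exacts [.inl h, .inr ⟨h, h'.le⟩]

/-- `Highest` looks only at cells from the current index on, which later steps do not modify. The
highest point can therefore be maintained in the sweep that builds the staircases. -/
theorem wp_stairStep {w n W : ℕ} {X Y : ℕ → ℝ} {s : State} (hw : n + 1 < 2 ^ w)
    (hWs : s.wreg 2 = W) (hX : SortedBlocks X n W)
    (H : StairInv X Y (s.rarr 0) (s.rarr 1) n W (s.wreg 6))
    (hf : Highest (s.rarr 0) (s.rarr 1) n (s.wreg 6) (s.rreg 4, s.rreg 5))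
    (h₀ : 0 < s.wreg 6) (hn : s.wreg 6 < n) :
    stairStep.wp w (fun s' => (StairInv X Y (s'.rarr 0) (s'.rarr 1) n W (s'.wreg 6) ∧
      Highest (s'.rarr 0) (s'.rarr 1) n (s'.wreg 6) (s'.rreg 4, s'.rreg 5) ∧ s'.wreg 6 < n) ∧
      s'.wreg 6 < s.wreg 6) s := by
  obtain ⟨i, hi⟩ : ∃ i, s.wreg 6 = i + 1 := ⟨s.wreg 6 - 1, by omega⟩
  have h₁ : 1 % 2 ^ w = 1 := Nat.mod_eq_of_lt (by omega)
  have h₂ : (i + 1) % 2 ^ w = i + 1 := Nat.mod_eq_of_lt (by omega)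
  rw [hi] at H hf hn ⊢
  suffices h : (Program.seq (.wset 6 (.sub (.reg 6) (.const 1))) stairCopy).wp w
      (fun s' => StairInv X Y (s'.rarr 0) (s'.rarr 1) n W i ∧
        Highest (s'.rarr 0) (s'.rarr 1) n (i + 1) (s'.rreg 4, s'.rreg 5) ∧ s'.wreg 6 = i) s by
    change (Program.seq (.wset 6 (.sub (.reg 6) (.const 1))) stairCopy).wp w
      (Program.wp w (.branch isHigher loadPoint .skip) _) s
    refine Program.wp_mono h fun s' ⟨H, ⟨⟨u, hu, hiu, e⟩, hf⟩, h₆⟩ => ⟨fun hb => ?_, fun hb => ?_⟩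
    · have hb' := highLe_of_isHigher hb
      simp only [loadPoint, Program.wp, WExp.eval, RExp.eval]
      simp only [h₆] at hb' ⊢
      simp [Function.update]
      refine ⟨H, ⟨⟨i, by omega, le_rfl, rfl, rfl⟩, fun t ht htn => ?_⟩, by omega⟩
      rcases ht.lt_or_eq with ht | rfl
      · exact (hf t ht htn).trans hb'
      · exact .inr ⟨rfl, le_rfl⟩
    · have hb' := not_isHigher hb
      rw [h₆] at hb'
      simp only [Program.wp, h₆]
      refine ⟨⟨H, ⟨⟨u, hu, by omega, e⟩, fun t ht htn => ?_⟩, by omega⟩, by omega⟩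
      rcases ht.lt_or_eq with ht | rfl
      · exact hf t ht htn
      · exact hb'
  simp only [stairCopy, Program.wp, WExp.eval, RExp.eval, BExp.Holds, not_lt]
  simp [h₁, hi, h₂, hWs]
  constructor
  · intro hdiv hY
    obtain ⟨⟨u, hu, hiu, e⟩, hf⟩ := hf
    have hiu' : u ≠ i := by omega
    refine ⟨H.copy hX hn (le_antisymm (Nat.div_le_div_right (by omega)) hdiv) hY,
      ⟨u, hu, hiu, by simpa [Function.update_of_ne hiu'] using e⟩, fun t ht htn => ?_⟩
    have hit : t ≠ i := by omega
    simpa [Function.update_of_ne hit] using hf t ht htn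
  · intro h
    exact ⟨H.keep hX fun e => h e.ge, hf⟩

theorem exec_stairs {w n W : ℕ} {s : State} (hw : n + 1 < 2 ^ w) (hn₀ : 0 < n)
    (hn : s.wreg 0 = n) (hWs : s.wreg 2 = W) (hX : SortedBlocks (s.rarr 0) n W) :
    ∃ t s', Exec w stairs s t s' ∧ t ≤ (stairStep.bound + 20) * (n + 1) ∧
      StairBlocks (s'.rarr 0) (s'.rarr 1) n W ∧
      front (s'.rarr 0) (s'.rarr 1) n = front (s.rarr 0) (s.rarr 1) n ∧
      Highest (s'.rarr 0) (s'.rarr 1) n 0 (s'.rreg 4, s'.rreg 5) := by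
  have h₁ : 1 % 2 ^ w = 1 := Nat.mod_eq_of_lt (by omega)
  obtain ⟨t₁, s₁, e₁, ht₁, h₆, h₄, h₅⟩ := (Program.seq (.wset 6 (.sub (.reg 0) (.const 1)))
    loadPoint).exec_of_wp (w := w) (s := s) (Q := fun s' => s'.wreg 6 = n - 1 ∧
      s'.rreg 4 = s.rarr 0 (n - 1) ∧ s'.rreg 5 = s.rarr 1 (n - 1))
    (by
      simp only [Program.wp, loadPoint, WExp.eval, RExp.eval]
      simp [h₁, hn])
  have f₁ := e₁.frame
  obtain ⟨t₂, s₂, e₂, f₂, ⟨H, hf, -⟩, h₂, ht₂⟩ := exec_loop_of_wp (w := w)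
    (b := .wlt (.const 0) (.reg 6)) (c := stairStep) (s₀ := s₁)
    (fun s' => StairInv (s.rarr 0) (s.rarr 1) (s'.rarr 0) (s'.rarr 1) n W (s'.wreg 6) ∧
      Highest (s'.rarr 0) (s'.rarr 1) n (s'.wreg 6) (s'.rreg 4, s'.rreg 5) ∧ s'.wreg 6 < n)
    (fun s' => s'.wreg 6)
    (by
      rw [f₁.rarr 0 rfl, f₁.rarr 1 rfl, h₆, h₄, h₅]
      refine ⟨.init _ _ (by omega), ⟨⟨n - 1, by omega, le_rfl, rfl, rfl⟩, fun t ht htn => ?_⟩,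
        by omega⟩
      obtain rfl : t = n - 1 := by omega
      exact .inr ⟨rfl, le_rfl⟩)
    fun s' f' ⟨H, hf, hlt⟩ hb => by
      simp only [BExp.Holds, WExp.eval, Nat.zero_mod] at hb
      exact wp_stairStep hw ((f'.wreg 2 rfl).trans ((f₁.wreg 2 rfl).trans hWs)) hX H hf hb hlt
  simp only [BExp.Holds, WExp.eval, Nat.zero_mod, not_lt, nonpos_iff_eq_zero] at h₂
  rw [h₂] at H hf
  refine ⟨_, s₂, .seq e₁ e₂, ?_, fun i j => H.chain i j (by omega), H.front_eq, hf⟩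
  have hb₁ : (Program.seq (.wset 6 (.sub (.reg 0) (.const 1))) loadPoint).bound = 10 := rfl
  have hb₂ : (BExp.wlt (.const 0) (.reg 6)).cost = 3 := rfl
  rw [hb₂, h₆, h₂, mul_zero, show n - 1 + 1 = n by omega] at ht₂
  generalize stairStep.bound = x at *
  have : (x + 20) * (n + 1) = (3 + x + 1) * n + (16 * n + x + 20) := by ring
  omega

end RealRAM

/-! ### Scanning the blocks with pointers that only advance -/

/-- The cell `j` is before the pointer of its block; `o b` is the offset of the pointer in the block
that begins at `b`. -/
def Passed (W : ℕ) (o : ℕ → ℕ) (j : ℕ) : Prop := j % W < o (j / W * W)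

/-- The total distance of the pointers from the ends of their blocks. -/
def pending (n W : ℕ) (o : ℕ → ℕ) : ℕ := ∑ b ∈ Finset.range (n / W + 1), (W - o (b * W))

/-- The amortization: pointers are never set back, so all advances of all scans are paid by the
initial value, which `pending_zero` bounds. -/
theorem pending_update {n W b : ℕ} {o : ℕ → ℕ} (hb : W ∣ b) (hbn : b ≤ n) (ho : o b < W) :
    pending n W (Function.update o b (o b + 1)) < pending n W o := by
  obtain ⟨c, rfl⟩ := hb
  have hW : 0 < W := by omega
  refine Finset.sum_lt_sum (fun d _ => ?_) ⟨c, ?_, ?_⟩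
  · by_cases h : d * W = W * c
    · rw [h, Function.update_self]; omega
    · rw [Function.update_of_ne h]
  · rw [Finset.mem_range, Nat.lt_succ_iff, Nat.le_div_iff_mul_le hW, mul_comm]
    exact hbn
  · rw [mul_comm c, Function.update_self]; omega

theorem pending_zero (n W : ℕ) : pending n W (fun _ => 0) ≤ n + W := by
  simp only [pending, Nat.sub_zero, Finset.sum_const, Finset.card_range, smul_eq_mul, add_mul,
    one_mul]
  have := Nat.div_mul_le_self n W
  omega

theorem passed_update_iff {W b : ℕ} {o : ℕ → ℕ} (hb : W ∣ b) (ho : o b < W) (j : ℕ) :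
    Passed W (Function.update o b (o b + 1)) j ↔ Passed W o j ∨ j = b + o b := by
  have hj := Nat.div_add_mod' j W
  unfold Passed
  by_cases h : j / W * W = b
  · rw [h, Function.update_self]
    omega
  · rw [Function.update_of_ne h]
    refine ⟨.inl, ?_⟩
    rintro (h' | rfl)
    · exact h'
    · rw [div_eq_of_dvd_of_lt hb (by omega) (by omega), Nat.div_mul_cancel hb] at h
      exact absurd rfl h

/-- Used to compare an unpassed cell with the cell at the pointer: both lie in one block, the
pointer not after the cell, so `StairBlocks` applies. -/
theorem not_passed_in_block {W b j : ℕ} {o : ℕ → ℕ} (hb : W ∣ b) (h₁ : b ≤ j) (h₂ : j < b + W)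
    (h : ¬ Passed W o j) : o b < W ∧ b + o b ≤ j ∧ (b + o b) / W = j / W := by
  have hj := Nat.div_add_mod' j W
  have e : j / W * W = b := by rw [div_eq_of_dvd_of_lt hb h₁ h₂, Nat.div_mul_cancel hb]
  unfold Passed at h
  rw [e] at hj h
  have ho : o b < W := by omega
  refine ⟨ho, by omega, ?_⟩
  rw [div_eq_of_dvd_of_lt hb h₁ h₂, div_eq_of_dvd_of_lt hb (by omega) (by omega)]

namespace RealRAM

/-- Is the pointer (array `a`) inside its block? -/
def inBlock (a : ℕ) : BExp :=
  .and (.wlt (.read a (.reg 3)) (.reg 2)) (.wlt (.reg 6) (.reg 0))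

/-- One step of a scan: if `T` holds for the point at the pointer of the current block, which begins
at word register `3`, then advance the pointer after `A`, otherwise go to the next block after
`S`. -/
def scanStep (a : ℕ) (T : BExp) (A S : Program) : Program :=
  .seq (.wset 6 (.add (.reg 3) (.read a (.reg 3)))) <|
  .branch (.and (inBlock a) T)
    (.seq A (.wstore a (.reg 3) (.add (.read a (.reg 3)) (.const 1))))
    (.seq S (.wset 3 (.add (.reg 3) (.reg 2))))

/-- Scan all blocks. -/
def scan (a : ℕ) (T : BExp) (A S : Program) : Program :=
  .seq (.wset 3 (.const 0)) (.loop (.wlt (.reg 3) (.reg 0)) (scanStep a T A S))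

/-- The pointer `i` of the current block, which begins at `b`. -/
structure AtPointer (n W a b i : ℕ) (s : State) : Prop where
  n_eq : s.wreg 0 = n
  W_eq : s.wreg 2 = W
  b_eq : s.wreg 3 = b
  i_eq : s.wreg 6 = i
  add_eq : b + s.warr a b = i
  dvd : W ∣ b

theorem AtPointer.inBlock_iff {w n W a b i : ℕ} {s : State} (h : AtPointer n W a b i s) :
    (inBlock a).Holds w s ↔ s.warr a b < W ∧ i < n := by
  simp [inBlock, BExp.Holds, WExp.eval, h.n_eq, h.W_eq, h.b_eq, h.i_eq]

/-- Steps per iteration of a scan. -/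
def scanCost (a : ℕ) (T : BExp) (A S : Program) : ℕ := (scanStep a T A S).bound + 4

/-- The common rule for the three queries. The invariant `J` speaks of the start of the current
block, the pointer offsets, word register `4` and the real registers. Every iteration either
advances a pointer, which lowers `pending`, or moves on to the next block. The steps are thus paid
by the number of blocks and the drop of `pending`, at `K` per unit. -/
theorem exec_scan {w n W a K : ℕ} {T : BExp} {A S : Program}
    (J : ℕ → (ℕ → ℕ) → ℕ → (ℕ → ℝ) → Prop) {s₀ : State} (hw : n + W + 1 < 2 ^ w) (hW : 0 < W)
    (hn : s₀.wreg 0 = n) (hWs : s₀.wreg 2 = W)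
    (h0 : (scan a T A S).setsW 0 = false) (h2 : (scan a T A S).setsW 2 = false)
    (hA : A.setsW 3 = false) (hA' : A.storesW a = false)
    (hK : scanCost a T A S ≤ K) (ho₀ : ∀ c, s₀.warr a c ≤ W)
    (h₀ : J 0 (s₀.warr a) (s₀.wreg 4) s₀.rreg)
    (hadv : ∀ s b i, Frame (scan a T A S) s₀ s → AtPointer n W a b i s → s.warr a b < W → i < n →
      T.Holds w s → J b (s.warr a) (s.wreg 4) s.rreg →
      A.wp w (fun s' => J b (Function.update (s.warr a) b (s.warr a b + 1)) (s'.wreg 4) s'.rreg) s)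
    (hS : S.setsW 3 = false) (hS' : S.storesW a = false)
    (hskip : ∀ s b i, Frame (scan a T A S) s₀ s → AtPointer n W a b i s →
      (s.warr a b < W → i < n → ¬ T.Holds w s) → J b (s.warr a) (s.wreg 4) s.rreg →
      S.wp w (fun s' => J (b + W) (s.warr a) (s'.wreg 4) s'.rreg) s) :
    ∃ t s', Exec w (scan a T A S) s₀ t s' ∧
      t + K * pending n W (s'.warr a) ≤ K * (n / W + 3 + pending n W (s₀.warr a)) ∧
      (∀ c, s'.warr a c ≤ W) ∧ ∃ b, n ≤ b ∧ J b (s'.warr a) (s'.wreg 4) s'.rreg := by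
  have h₁ : 1 % 2 ^ w = 1 := Nat.mod_eq_of_lt (by omega)
  have e₁ := Exec.wset (w := w) 3 (.const 0) s₀
  set s₁ : State := { s₀ with wreg := Function.update s₀.wreg 3 (WExp.eval w s₀ (.const 0)) }
    with hs₁
  have f₁ : Frame (scan a T A S) s₀ s₁ := e₁.frame.mono
    (fun v hv => by simp_all [scan, Program.setsW]) (fun v hv => by simp_all [Program.setsR])
    (fun v hv => by simp_all [Program.storesW]) (fun v hv => by simp_all [Program.storesR])
  obtain ⟨t₂, s₂, e₂, f₂, ⟨hJ, hdvd, ho⟩, hb₂, ht₂⟩ := exec_loop_of_wp (w := w)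
    (b := .wlt (.reg 3) (.reg 0)) (c := scanStep a T A S) (s₀ := s₁)
    (fun s => J (s.wreg 3) (s.warr a) (s.wreg 4) s.rreg ∧ W ∣ s.wreg 3 ∧
      ∀ c, s.warr a c ≤ W)
    (fun s => n / W + 1 - s.wreg 3 / W + pending n W (s.warr a))
    (by simpa [hs₁, WExp.eval] using ⟨h₀, ho₀⟩) fun s f ⟨hJ, hdvd, ho⟩ hb => by
      have f : Frame (scan a T A S) s₀ s := f₁.trans (f.mono
        (fun v hv => by simp_all [scan, Program.setsW])
        (fun v hv => by simp_all [scan, Program.setsR])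
        (fun v hv => by simp_all [scan, Program.storesW])
        (fun v hv => by simp_all [scan, Program.storesR]))
      have hn : s.wreg 0 = n := (f.wreg 0 h0).trans hn
      have hWs : s.wreg 2 = W := (f.wreg 2 h2).trans hWs
      simp only [BExp.Holds, WExp.eval, hn] at hb
      obtain ⟨b, hb'⟩ : ∃ b, s.wreg 3 = b := ⟨_, rfl⟩
      rw [hb'] at hb hdvd hJ ⊢
      have hob := ho b
      have e₂ : (b + s.warr a b) % 2 ^ w = b + s.warr a b := Nat.mod_eq_of_lt (by omega)
      have e₃ : (b + W) % 2 ^ w = b + W := Nat.mod_eq_of_lt (by omega)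
      have e₄ : (s.warr a b + 1) % 2 ^ w = s.warr a b + 1 := Nat.mod_eq_of_lt (by omega)
      have e := Exec.wset (w := w) 6 (.add (.reg 3) (.read a (.reg 3))) s
      change Program.wp w (.branch (.and (inBlock a) T)
        (.seq A (.wstore a (.reg 3) (.add (.read a (.reg 3)) (.const 1))))
        (.seq S (.wset 3 (.add (.reg 3) (.reg 2))))) _
        { s with wreg := Function.update s.wreg 6 (WExp.eval w s _) }
      set s' : State := { s with wreg := Function.update s.wreg 6 (WExp.eval w s
        (.add (.reg 3) (.read a (.reg 3)))) } with hs'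
      have f' : Frame (scan a T A S) s₀ s' := f.trans (e.frame.mono
        (fun v hv => by simp_all [scan, scanStep, Program.setsW])
        (fun v hv => by simp_all [Program.setsR]) (fun v hv => by simp_all [Program.storesW])
        (fun v hv => by simp_all [Program.storesR]))
      have hat : AtPointer n W a b (b + s.warr a b) s' :=
        ⟨by simp [hs', hn], by simp [hs', hWs], by simp [hs', hb'],
          by simp [hs', WExp.eval, hb', e₂], rfl, hdvd⟩
      have h4 : s'.wreg 4 = s.wreg 4 := by simp [hs']
      constructor
      · rintro ⟨hin, hT⟩
        obtain ⟨hlt, hin⟩ := hat.inBlock_iff.1 hin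
        change A.wp w (Program.wp w (.wstore a (.reg 3) (.add (.read a (.reg 3)) (.const 1))) _) s'
        -- The program `A` is arbitrary here; the frame of its execution shows that the block start
        -- and the pointers are unchanged before the advance.
        refine Program.wp_mono_exec (hadv s' b _ f' hat hlt hin hT (h4 ▸ hJ)) fun t s'' e' hJ' => ?_
        have h₃ : s''.wreg 3 = b := (e'.frame.wreg 3 hA).trans hat.b_eq
        have hwa : s''.warr a = s.warr a := e'.frame.warr a hA'
        have hpend := pending_update hdvd hb.le hlt
        simp only [Program.wp, WExp.eval, h₃, hwa, h₁, e₄, Function.update_self]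
        refine ⟨⟨hJ', hdvd, fun c => ?_⟩, Nat.add_lt_add_left hpend _⟩
        rcases eq_or_ne c b with rfl | hc
        · rw [Function.update_self]
          exact hlt
        · rw [Function.update_of_ne hc]
          exact ho c
      · intro hn'
        have hT : s'.warr a b < W → b + s.warr a b < n → ¬ T.Holds w s' :=
          fun h h' hT => hn' ⟨hat.inBlock_iff.2 ⟨h, h'⟩, hT⟩
        change S.wp w (Program.wp w (.wset 3 (.add (.reg 3) (.reg 2))) _) s'
        refine Program.wp_mono_exec (hskip s' b _ f' hat hT (h4 ▸ hJ)) fun t s'' e' hJ' => ?_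
        have h₃ : s''.wreg 3 = b := (e'.frame.wreg 3 hS).trans hat.b_eq
        have hwa : s''.warr a = s.warr a := e'.frame.warr a hS'
        have hf : Frame (scan a T A S) s' s'' := e'.frame.mono
          (fun v hv => by simp_all [scan, scanStep, Program.setsW])
          (fun v hv => by simp_all [scan, scanStep, Program.setsR])
          (fun v hv => by simp_all [scan, scanStep, Program.storesW])
          (fun v hv => by simp_all [scan, scanStep, Program.storesR])
        have hWs : s''.wreg 2 = W := (hf.wreg 2 h2).trans hat.W_eq
        simp only [Program.wp, WExp.eval, h₃, hwa, hWs, e₃, Function.update_self]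
        refine ⟨⟨?_, hdvd.add (dvd_refl W), ho⟩, Nat.add_lt_add_right ?_ _⟩
        · simpa using hJ'
        · have : b / W ≤ n / W := Nat.div_le_div_right hb.le
          rw [Nat.add_div_right _ hW]
          omega
  have hn₂ : s₂.wreg 0 = n := by
    refine (f₂.wreg 0 ?_).trans ?_
    · simp_all [scan, Program.setsW]
    · simpa [hs₁] using hn
  simp only [BExp.Holds, WExp.eval, hn₂, not_lt] at hb₂
  refine ⟨_, s₂, .seq e₁ e₂, ?_, ho, _, hb₂, hJ⟩
  have hc : (BExp.wlt (.reg 3) (.reg 0)).cost + (scanStep a T A S).bound + 1 =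
      scanCost a T A S := by
    simp only [BExp.cost, WExp.cost, scanCost]; omega
  have hc' : 4 ≤ scanCost a T A S := by simp only [scanCost]; omega
  have hw₁ : s₁.wreg 3 = 0 := by simp [hs₁, WExp.eval]
  have hc₀ : (WExp.const 0).cost = 1 := rfl
  rw [hc, hw₁, Nat.zero_div, Nat.sub_zero, show s₁.warr a = s₀.warr a from rfl] at ht₂
  rw [hc₀]
  clear hc
  generalize scanCost a T A S = K' at *
  obtain ⟨d, rfl⟩ := Nat.exists_eq_add_of_le hK
  have h₅ : K' * pending n W (s₂.warr a) ≤
      K' * (n / W + 1 - s₂.wreg 3 / W + pending n W (s₂.warr a)) :=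
    Nat.mul_le_mul_left _ (Nat.le_add_left _ _)
  have h₆ : K' * (n / W + 3 + pending n W (s₀.warr a)) =
      K' * (n / W + 1 + pending n W (s₀.warr a) + 1) + K' := by ring
  -- Replacing the actual cost `K'` by `K = K' + d` also rescales `pending`. The extra terms compare
  -- correctly by this inequality, obtained by cancelling `K'`.
  have h₇ : pending n W (s₂.warr a) ≤ n / W + 3 + pending n W (s₀.warr a) :=
    Nat.le_of_mul_le_mul_left (by omega : K' * _ ≤ K' * _) (by omega)
  have h₈ := Nat.mul_le_mul_left d h₇
  rw [add_mul, add_mul]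
  omega

/-! ### The queries of the greedy algorithm -/

/-- Is the point at the pointer not to the right of the point `p` in the real registers `1`, `2`,
or within the distance in the real register `0` from `p`? -/
def isNear : BExp :=
  .or (.not (.rlt (.reg 1) (.read 0 (.reg 6))))
    (.not (.rlt (.mul (.reg 0) (.reg 0))
      (.add (.mul (.sub (.reg 1) (.read 0 (.reg 6))) (.sub (.reg 1) (.read 0 (.reg 6))))
        (.mul (.sub (.reg 2) (.read 1 (.reg 6))) (.sub (.reg 2) (.read 1 (.reg 6)))))))

/-- Pass all points that are near to `p`; their largest abscissa gets into real register `3`. -/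
def passNear : Program :=
  scan 0 isNear
    (.branch (.rlt (.reg 3) (.read 0 (.reg 6))) (.rset 3 (.read 0 (.reg 6))) .skip) .skip

/-- Pass all points with abscissa at most that in real register `3`, and load the highest one of
the others, if any; word register `4` tells whether there is one. -/
def findNext : Program :=
  scan 0 (.not (.rlt (.reg 3) (.read 0 (.reg 6)))) .skip
    (.branch (.and (inBlock 0) (.or (.not (.wlt (.const 0) (.reg 4))) isHigher))
      (.seq loadPoint (.wset 4 (.const 1))) .skip)

/-- Load the rightmost point above the height in real register `5` into the real registers
`6`, `7`. -/
def findLast : Program :=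
  scan 1 (.rlt (.reg 5) (.read 1 (.reg 6)))
    (.branch (.or (.rlt (.reg 6) (.read 0 (.reg 6)))
        (.and (.not (.rlt (.read 0 (.reg 6)) (.reg 6))) (.rlt (.reg 7) (.read 1 (.reg 6)))))
      (.seq (.rset 6 (.read 0 (.reg 6))) (.rset 7 (.read 1 (.reg 6)))) .skip)
    .skip

/-- The part of the memory that stays fixed during the greedy algorithm. -/
structure Setup (X Y : ℕ → ℝ) (n W : ℕ) (lam : ℝ) (s : State) : Prop where
  n_eq : s.wreg 0 = n
  W_eq : s.wreg 2 = W
  X_eq : s.rarr 0 = X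
  Y_eq : s.rarr 1 = Y
  lam_eq : s.rreg 0 = lam

theorem Setup.of_frame {X Y : ℕ → ℝ} {n W : ℕ} {lam : ℝ} {s s' : State} {c : Program}
    (h : Setup X Y n W lam s) (f : Frame c s s') (h₁ : c.setsW 0 = false) (h₂ : c.setsW 2 = false)
    (h₃ : c.storesR 0 = false) (h₄ : c.storesR 1 = false) (h₅ : c.setsR 0 = false) :
    Setup X Y n W lam s' :=
  ⟨(f.wreg 0 h₁).trans h.n_eq, (f.wreg 2 h₂).trans h.W_eq, (f.rarr 0 h₃).trans h.X_eq,
    (f.rarr 1 h₄).trans h.Y_eq, (f.rreg 0 h₅).trans h.lam_eq⟩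

variable {w n W : ℕ} {X Y : ℕ → ℝ} {lam : ℝ} {s : State}

theorem isNear_iff {b i a : ℕ} (h : Setup X Y n W lam s) (hat : AtPointer n W a b i s) :
    isNear.Holds w s ↔ X i ≤ s.rreg 1 ∨ sqDist (s.rreg 1, s.rreg 2) (X i, Y i) ≤ lam * lam := by
  simp [isNear, BExp.Holds, RExp.eval, WExp.eval, h.X_eq, h.Y_eq, h.lam_eq, hat.i_eq, sqDist]

/-- Within a block, the points to the right of `p` recede from `p`, so everything after the first
far point is far. A passed point need not be on the skyline, but a skyline point `z` between `p` and
its abscissa is nested between the two and therefore near. By `hnone`, earlier passes have not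
reached a skyline point beyond `p`. -/
theorem exec_passNear (hw : n + W + 1 < 2 ^ w) (hW : 0 < W) (hs : Setup X Y n W lam s)
    (hXY : StairBlocks X Y n W) {p : ℝ × ℝ} (hp : p ∈ front X Y n) (hp₁ : s.rreg 1 = p.1)
    (hp₂ : s.rreg 2 = p.2) (ho : ∀ c, s.warr 0 c ≤ W)
    (hpass : ∀ j < n, Passed W (s.warr 0) j → X j ≤ s.rreg 3)
    (hnone : ∀ z ∈ front X Y n, p.1 < z.1 → s.rreg 3 < z.1) :
    ∃ t s', Exec w passNear s t s' ∧
      t + 90 * pending n W (s'.warr 0) ≤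
        90 * (n / W + 3 + pending n W (s.warr 0)) ∧
      (∀ c, s'.warr 0 c ≤ W) ∧
      (∀ j < n, Passed W (s'.warr 0) j → X j ≤ s'.rreg 3) ∧
      ∀ z ∈ front X Y n, p.1 ≤ z.1 → (z.1 ≤ s'.rreg 3 ↔ sqDist p z ≤ lam * lam) := by
  have hS := staircase_front X Y n
  obtain ⟨t, s', e, ht, ho', b, hb, hpass', hnear, hfar⟩ := exec_scan (w := w) (a := 0) (K := 90)
    (T := isNear)
    (A := .branch (.rlt (.reg 3) (.read 0 (.reg 6))) (.rset 3 (.read 0 (.reg 6))) .skip)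
    (S := .skip)
    (fun b o _ r => (∀ j < n, Passed W o j → X j ≤ r 3) ∧
      (∀ z ∈ front X Y n, p.1 ≤ z.1 → z.1 ≤ r 3 → sqDist p z ≤ lam * lam) ∧
      ∀ j < n, j < b → ¬ Passed W o j → p.1 ≤ X j → lam * lam < sqDist p (X j, Y j))
    hw hW hs.n_eq hs.W_eq rfl rfl rfl rfl (by decide) ho
    (by
      refine ⟨hpass, fun z hz h₁ h₂ => ?_, fun j _ hj => absurd hj (Nat.not_lt_zero j)⟩
      rcases h₁.lt_or_eq with h₁ | h₁
      · exact absurd (hnone z hz h₁) (not_lt.2 h₂)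
      · obtain rfl := (hS p hp z hz h₁.le).2 h₁
        simpa [sqDist] using mul_self_nonneg lam)
    (by
      intro s' b i f hat hlt hin hT ⟨hpass, hnear, hfar⟩
      have hs' := hs.of_frame f rfl rfl rfl rfl rfl
      have hp₁' : s'.rreg 1 = p.1 := (f.rreg 1 rfl).trans hp₁
      have hp₂' : s'.rreg 2 = p.2 := (f.rreg 2 rfl).trans hp₂
      rw [isNear_iff hs' hat, hp₁', hp₂'] at hT
      have hfar' : ∀ j < n, j < b →
          ¬ Passed W (Function.update (s'.warr 0) b (s'.warr 0 b + 1)) j → p.1 ≤ X j →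
          lam * lam < sqDist p (X j, Y j) := fun j hj hjb hnp =>
        hfar j hj hjb fun h => hnp ((passed_update_iff hat.dvd hlt j).2 (.inl h))
      simp only [Program.wp, BExp.Holds, RExp.eval, WExp.eval, hat.i_eq, hs'.X_eq,
        Function.update_self]
      refine ⟨fun hlt' => ⟨fun j hj hP => ?_, fun z hz h₁ h₂ => ?_, hfar'⟩,
        fun hle => ⟨fun j hj hP => ?_, hnear, hfar'⟩⟩
      · rcases (passed_update_iff hat.dvd hlt j).1 hP with hP | rfl
        · exact (hpass j hj hP).trans hlt'.le
        · rw [hat.add_eq]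
      · rcases hT with hT | hT
        · obtain rfl := (hS p hp z hz h₁).2 (le_antisymm h₁ (h₂.trans hT))
          simpa [sqDist] using mul_self_nonneg lam
        -- The point `i` is not to the left of `z`, so it is not higher than `z`, as `z` is on the
        -- skyline.
        · refine le_trans (sqDist_le_of_nested le_rfl h₁ h₂ le_rfl (hS p hp z hz h₁).1 ?_) hT
          rcases hz.2 i hin with h | h | h <;> dsimp only <;> linarith
      · rcases (passed_update_iff hat.dvd hlt j).1 hP with hP | rfl
        · exact hpass j hj hP
        · rw [hat.add_eq]
          exact not_lt.1 hle)
    rfl rfl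
    (by
      intro s' b i f hat hT ⟨hpass, hnear, hfar⟩
      have hs' := hs.of_frame f rfl rfl rfl rfl rfl
      have hp₁' : s'.rreg 1 = p.1 := (f.rreg 1 rfl).trans hp₁
      have hp₂' : s'.rreg 2 = p.2 := (f.rreg 2 rfl).trans hp₂
      rw [isNear_iff hs' hat, hp₁', hp₂', not_or, not_le, not_le] at hT
      refine ⟨hpass, hnear, fun j hj hjb hnp hpj => ?_⟩
      by_cases hjb' : j < b
      · exact hfar j hj hjb' hnp hpj
      · obtain ⟨h₁, h₂, h₃⟩ := not_passed_in_block hat.dvd (not_lt.1 hjb') hjb hnp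
        rw [hat.add_eq] at h₂ h₃
        obtain ⟨h₄, h₅⟩ := hT h₁ (by omega)
        obtain ⟨h₆, h₇⟩ := hXY i j h₂ hj h₃
        refine h₅.trans_le (sqDist_le_of_nested le_rfl h₄.le h₆ le_rfl ?_ ?_)
        · have := hp.2 i (by omega)
          rcases this with h | h | h <;> dsimp only <;> linarith
        · rcases h₇ with h | h <;> dsimp only <;> linarith)
  refine ⟨t, s', e, ht, ho', hpass', fun z hz h => ⟨hnear z hz h, fun h' => ?_⟩⟩
  obtain ⟨⟨j, hj, e₁, e₂⟩, -⟩ := hz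
  by_contra hlt
  have := hfar j hj (by omega) (fun hP => hlt (e₁ ▸ hpass' j hj hP)) (e₁ ▸ h)
  rw [e₁, e₂] at this
  exact absurd h' (not_le.2 this)

/-- Once the points up to the threshold are passed, the point at a pointer is the highest of the
remaining ones in its block. The highest of these over all blocks, rightmost among ties, is the
first skyline point beyond the threshold: the points up to the threshold lie to its left and cannot
dominate it. -/
theorem exec_findNext (hw : n + W + 1 < 2 ^ w) (hW : 0 < W) (hs : Setup X Y n W lam s)
    (hXY : StairBlocks X Y n W) (ho : ∀ c, s.warr 0 c ≤ W)
    (hpass : ∀ j < n, Passed W (s.warr 0) j → X j ≤ s.rreg 3) (h4 : s.wreg 4 = 0) :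
    ∃ t s', Exec w findNext s t s' ∧
      t + 90 * pending n W (s'.warr 0) ≤
        90 * (n / W + 3 + pending n W (s.warr 0)) ∧
      (∀ c, s'.warr 0 c ≤ W) ∧
      (∀ j < n, Passed W (s'.warr 0) j → X j ≤ s.rreg 3) ∧
      (s'.wreg 4 = 0 ∧ (∀ z ∈ front X Y n, z.1 ≤ s.rreg 3) ∨
        s'.wreg 4 = 1 ∧ (s'.rreg 4, s'.rreg 5) ∈ front X Y n ∧ s.rreg 3 < s'.rreg 4 ∧
          ∀ z ∈ front X Y n, s.rreg 3 < z.1 → s'.rreg 4 ≤ z.1) := by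
  obtain ⟨t, s', e, ht, ho', b, hb, hpass', hcov, hsrc⟩ := exec_scan (w := w) (a := 0) (K := 90)
    (T := .not (.rlt (.reg 3) (.read 0 (.reg 6)))) (A := .skip)
    (S := .branch (.and (inBlock 0) (.or (.not (.wlt (.const 0) (.reg 4))) isHigher))
      (.seq loadPoint (.wset 4 (.const 1))) .skip)
    (fun b o g r => (∀ j < n, Passed W o j → X j ≤ s.rreg 3) ∧
      (∀ j < n, j < b → s.rreg 3 < X j → g = 1 ∧ HighLe (X j, Y j) (r 4, r 5)) ∧
      (g = 0 ∨ g = 1 ∧ s.rreg 3 < r 4 ∧ ∃ j < n, X j = r 4 ∧ Y j = r 5))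
    hw hW hs.n_eq hs.W_eq rfl rfl rfl rfl (by decide) ho
    ⟨hpass, fun j _ hj => absurd hj (Nat.not_lt_zero j), .inl h4⟩
    (by
      intro s' b i f hat hlt hin hT ⟨hpass, hcov, hsrc⟩
      have hs' := hs.of_frame f rfl rfl rfl rfl rfl
      have hq : s'.rreg 3 = s.rreg 3 := f.rreg 3 rfl
      simp only [BExp.Holds, RExp.eval, WExp.eval, hat.i_eq, hs'.X_eq, hq, not_lt] at hT
      refine ⟨fun j hj hP => ?_, hcov, hsrc⟩
      rcases (passed_update_iff hat.dvd hlt j).1 hP with hP | rfl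
      · exact hpass j hj hP
      · rw [hat.add_eq]
        exact hT)
    rfl rfl
    (by
      intro s' b i f hat hT ⟨hpass, hcov, hsrc⟩
      have hs' := hs.of_frame f rfl rfl rfl rfl rfl
      have hq : s'.rreg 3 = s.rreg 3 := f.rreg 3 rfl
      simp only [BExp.Holds, RExp.eval, WExp.eval, hat.i_eq, hs'.X_eq, hq, not_not] at hT
      -- A point beyond the threshold has not been passed, so the staircase puts the point at the
      -- pointer at least as high.
      have hrest : ∀ j < n, j < b + W → ¬ j < b → s.rreg 3 < X j →
          s'.warr 0 b < W ∧ i < n ∧ HighLe (X j, Y j) (X i, Y i) := by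
        intro j hj hjb hjb' hjx
        obtain ⟨h₁, h₂, h₃⟩ := not_passed_in_block hat.dvd (not_lt.1 hjb') hjb
          fun hP => absurd (hpass j hj hP) (not_le.2 hjx)
        rw [hat.add_eq] at h₂ h₃
        obtain ⟨h₆, h₇⟩ := hXY i j h₂ hj h₃
        refine ⟨h₁, by omega, ?_⟩
        rcases h₇ with h₇ | h₇
        exacts [.inl h₇, .inr ⟨h₇.2.symm, h₇.1.ge⟩]
      have h₁ : 1 % 2 ^ w = 1 := Nat.mod_eq_of_lt (by omega)
      constructor
      · rintro ⟨hin, hnew⟩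
        obtain ⟨hlt, hin⟩ := hat.inBlock_iff.1 hin
        simp only [loadPoint, Program.wp, RExp.eval, WExp.eval, hat.i_eq, hs'.X_eq, hs'.Y_eq]
        simp only [Function.update_self, h₁, ne_eq, Nat.reduceEqDiff,
          not_false_eq_true, Function.update_of_ne]
        refine ⟨hpass, fun j hj hjb hjx => ⟨trivial, ?_⟩,
          .inr ⟨trivial, hT hlt hin, i, hin, rfl, rfl⟩⟩
        by_cases hjb' : j < b
        · obtain ⟨hg, hle⟩ := hcov j hj hjb' hjx
          refine hle.trans ?_
          rcases hnew with hnew | hnew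
          · simp [BExp.Holds, WExp.eval, hg] at hnew
          · simpa only [hat.i_eq, hs'.X_eq, hs'.Y_eq] using highLe_of_isHigher hnew
        · exact (hrest j hj hjb hjb' hjx).2.2
      · intro hold
        refine ⟨hpass, fun j hj hjb hjx => ?_, hsrc⟩
        by_cases hjb' : j < b
        · exact hcov j hj hjb' hjx
        · obtain ⟨hlt, hin, hle⟩ := hrest j hj hjb hjb' hjx
          have hold' : ¬ (BExp.or (.not (.wlt (.const 0) (.reg 4))) isHigher).Holds w s' :=
            fun h => hold ⟨hat.inBlock_iff.2 ⟨hlt, hin⟩, h⟩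
          obtain ⟨hg, hnot⟩ := not_or.1 hold'
          simp only [BExp.Holds, WExp.eval, Nat.zero_mod, not_not] at hg
          have hnot := not_isHigher hnot
          simp only [hat.i_eq, hs'.X_eq, hs'.Y_eq] at hnot
          refine ⟨?_, hle.trans hnot⟩
          rcases hsrc with h | h
          · omega
          · exact h.1)
  refine ⟨t, s', e, ht, ho', hpass', ?_⟩
  have hcov' : ∀ j < n, s.rreg 3 < X j → s'.wreg 4 = 1 ∧ HighLe (X j, Y j) (s'.rreg 4, s'.rreg 5) :=
    fun j hj => hcov j hj (by omega)
  rcases hsrc with h | ⟨h, hlt, u, hu, e₁, e₂⟩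
  · refine .inl ⟨h, ?_⟩
    rintro z ⟨⟨j, hj, e₁, -⟩, -⟩
    by_contra! hlt
    have := (hcov' j hj (e₁ ▸ hlt)).1
    omega
  · refine .inr ⟨h, ⟨⟨u, hu, e₁, e₂⟩, fun j hj => ?_⟩, hlt, ?_⟩
    · by_cases hjx : s.rreg 3 < X j
      · rcases (hcov' j hj hjx).2 with h | ⟨h, h'⟩
        · exact .inr (.inl h)
        · rcases h'.lt_or_eq with h' | h'
          exacts [.inl h', .inr (.inr ⟨h', h⟩)]
      · exact .inl ((not_lt.1 hjx).trans_lt hlt)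
    · rintro z ⟨⟨j, hj, e₃, e₄⟩, hz⟩ hlt'
      have h₁ := (hcov' j hj (e₃ ▸ hlt')).2
      have h₂ := hz u hu
      rw [e₁, e₂] at h₂
      rw [e₃, e₄] at h₁
      rcases h₂ with h₂ | h₂ | h₂
      · exact h₂.le
      · rcases h₁ with h₁ | h₁ <;> dsimp only at h₁ <;> linarith
      · exact h₂.1.le

/-- The points above a given height form a prefix of each block. `HighLe` is used with swapped
coordinates, so the running maximum is the rightmost passed point, the highest among ties. It may
stem from an earlier call: it remains valid because its height exceeds the current threshold. -/
theorem exec_findLast (hw : n + W + 1 < 2 ^ w) (hW : 0 < W) (hs : Setup X Y n W lam s)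
    (hXY : StairBlocks X Y n W) (ho : ∀ c, s.warr 1 c ≤ W)
    (hpass : ∀ j < n, Passed W (s.warr 1) j → HighLe (Y j, X j) (s.rreg 7, s.rreg 6))
    (hmem : ∃ j < n, X j = s.rreg 6 ∧ Y j = s.rreg 7) (hlt : s.rreg 5 < s.rreg 7) :
    ∃ t s', Exec w findLast s t s' ∧
      t + 90 * pending n W (s'.warr 1) ≤
        90 * (n / W + 3 + pending n W (s.warr 1)) ∧
      (∀ c, s'.warr 1 c ≤ W) ∧
      (∀ j < n, Passed W (s'.warr 1) j → HighLe (Y j, X j) (s'.rreg 7, s'.rreg 6)) ∧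
      (s'.rreg 6, s'.rreg 7) ∈ front X Y n ∧ s.rreg 5 < s'.rreg 7 ∧
      ∀ z ∈ front X Y n, s.rreg 5 < z.2 → z.1 ≤ s'.rreg 6 := by
  obtain ⟨t, s', e, ht, ho', b, hb, hpass', hmem', hlt', hcov⟩ := exec_scan (w := w) (a := 1)
    (K := 90) (T := .rlt (.reg 5) (.read 1 (.reg 6)))
    (A := .branch (.or (.rlt (.reg 6) (.read 0 (.reg 6)))
        (.and (.not (.rlt (.read 0 (.reg 6)) (.reg 6))) (.rlt (.reg 7) (.read 1 (.reg 6)))))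
      (.seq (.rset 6 (.read 0 (.reg 6))) (.rset 7 (.read 1 (.reg 6)))) .skip)
    (S := .skip)
    (fun b o _ r => (∀ j < n, Passed W o j → HighLe (Y j, X j) (r 7, r 6)) ∧
      (∃ j < n, X j = r 6 ∧ Y j = r 7) ∧ s.rreg 5 < r 7 ∧
      ∀ j < n, j < b → s.rreg 5 < Y j → Passed W o j)
    hw hW hs.n_eq hs.W_eq rfl rfl rfl rfl (by decide) ho
    ⟨hpass, hmem, hlt, fun j _ hj => absurd hj (Nat.not_lt_zero j)⟩
    (by
      intro s' b i f hat hlt hin hT ⟨hpass, hmem, hlt', hcov⟩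
      have hs' := hs.of_frame f rfl rfl rfl rfl rfl
      have hq : s'.rreg 5 = s.rreg 5 := f.rreg 5 rfl
      simp only [BExp.Holds, RExp.eval, WExp.eval, hat.i_eq, hs'.Y_eq, hq] at hT
      have hcov' : ∀ j < n, j < b → s.rreg 5 < Y j →
          Passed W (Function.update (s'.warr 1) b (s'.warr 1 b + 1)) j := fun j hj hjb hjy =>
        (passed_update_iff hat.dvd hlt j).2 (.inl (hcov j hj hjb hjy))
      simp only [Program.wp, BExp.Holds, RExp.eval, WExp.eval, hat.i_eq, hs'.X_eq, hs'.Y_eq]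
      simp only [Function.update_self, ne_eq, Nat.reduceEqDiff,
        not_false_eq_true, Function.update_of_ne, not_or, not_and, not_lt]
      refine ⟨fun h => ⟨fun j hj hP => ?_, ⟨i, hin, rfl, rfl⟩, hT, hcov'⟩,
        fun h => ⟨fun j hj hP => ?_, hmem, hlt', hcov'⟩⟩
      · rcases (passed_update_iff hat.dvd hlt j).1 hP with hP | rfl
        · refine (hpass j hj hP).trans ?_
          rcases h with h | ⟨h, h'⟩
          · exact .inl h
          · rcases h.lt_or_eq with h | h
            exacts [.inl h, .inr ⟨h, h'.le⟩]
        · rw [hat.add_eq]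
          exact .inr ⟨rfl, le_rfl⟩
      · rcases (passed_update_iff hat.dvd hlt j).1 hP with hP | rfl
        · exact hpass j hj hP
        · rw [hat.add_eq]
          rcases h.1.lt_or_eq with h' | h'
          exacts [.inl h', .inr ⟨h', h.2 h'.ge⟩])
    rfl rfl
    (by
      intro s' b i f hat hT ⟨hpass, hmem, hlt', hcov⟩
      have hs' := hs.of_frame f rfl rfl rfl rfl rfl
      have hq : s'.rreg 5 = s.rreg 5 := f.rreg 5 rfl
      simp only [BExp.Holds, RExp.eval, WExp.eval, hat.i_eq, hs'.Y_eq, hq, not_lt] at hT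
      refine ⟨hpass, hmem, hlt', fun j hj hjb hjy => ?_⟩
      by_cases hjb' : j < b
      · exact hcov j hj hjb' hjy
      · by_contra hnp
        obtain ⟨h₁, h₂, h₃⟩ := not_passed_in_block hat.dvd (not_lt.1 hjb') hjb hnp
        rw [hat.add_eq] at h₂ h₃
        have h₄ := hT h₁ (by omega)
        rcases (hXY i j h₂ hj h₃).2 with h | h <;> linarith)
  have hle : ∀ j < n, s.rreg 5 < Y j → HighLe (Y j, X j) (s'.rreg 7, s'.rreg 6) := fun j hj hjy =>
    hpass' j hj (hcov j hj (by omega) hjy)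
  refine ⟨t, s', e, ht, ho', hpass', ⟨hmem', fun j hj => ?_⟩, hlt', ?_⟩
  · by_cases hjy : s.rreg 5 < Y j
    · rcases hle j hj hjy with h | ⟨h, h'⟩
      · exact .inl h
      · rcases h'.lt_or_eq with h' | h'
        exacts [.inr (.inl h'), .inr (.inr ⟨h, h'⟩)]
    · exact .inr (.inl ((not_lt.1 hjy).trans_lt hlt'))
  · rintro z ⟨⟨j, hj, e₃, e₄⟩, -⟩ hzy
    rw [← e₃]
    rcases hle j hj (e₄ ▸ hzy) with h | ⟨h, -⟩
    exacts [h.le, h.le]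

end RealRAM

/-! ### The rounds of the greedy algorithm -/

theorem lt_of_mem_front {X Y : ℕ → ℝ} {n : ℕ} {p q : ℝ × ℝ} (hp : p ∈ front X Y n)
    (hq : q ∈ front X Y n) (h : p.1 < q.1) : q.2 < p.2 := by
  obtain ⟨j, hj, e₁, e₂⟩ := hq.1
  have := hp.2 j hj
  rw [e₁, e₂] at this
  rcases this with h' | h' | h' <;> linarith

theorem sqDist_self_le (p : ℝ × ℝ) (lam : ℝ) : sqDist p p ≤ lam * lam := by
  simpa [sqDist] using mul_self_nonneg lam

namespace RealRAM

/-- Load the first point of the skyline that is to the right of the point in the real registers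
`u`, `v` and not within the given distance from it, if any. -/
def reach (u v : ℕ) : Program :=
  .seq (.seq (.rset 1 (.reg u)) (.rset 2 (.reg v))) <|
  .seq passNear <|
  .seq (.wset 4 (.const 0)) findNext

/-- Place one centre: `l` is the first point of the skyline that is not yet covered. -/
def round : Program :=
  .seq (reach 4 5) <|
  .seq (.branch (.wlt (.const 0) (.reg 4)) (.seq findLast (reach 6 7)) .skip) <|
  .seq (.branch (.wlt (.const 0) (.reg 4)) .skip (.wset 5 (.const 1))) <|
  .wset 1 (.sub (.reg 1) (.const 1))

/-- Place centres while there are any left and some point is not covered. -/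
def rounds : Program :=
  .loop (.and (.wlt (.const 0) (.reg 1)) (.wlt (.reg 5) (.const 1))) round

variable {w n W : ℕ} {X Y : ℕ → ℝ} {lam : ℝ} {s : State}

/-- The register `v` is read after register `1` has been overwritten, hence `v ≠ 1`. The two scans
cost `90` per unit each; the remaining `4` pays for the assignments. That register `3` stays below
the point found provides `hnone` for the next call. -/
theorem exec_reach (hw : n + W + 1 < 2 ^ w) (hW : 0 < W) (hs : Setup X Y n W lam s)
    (hXY : StairBlocks X Y n W) {u v : ℕ} (hv : v ≠ 1) {p : ℝ × ℝ} (hp : p ∈ front X Y n)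
    (hp₁ : s.rreg u = p.1) (hp₂ : s.rreg v = p.2) (ho : ∀ c, s.warr 0 c ≤ W)
    (hpass : ∀ j < n, Passed W (s.warr 0) j → X j ≤ s.rreg 3)
    (hnone : ∀ z ∈ front X Y n, p.1 < z.1 → s.rreg 3 < z.1) :
    ∃ t s', Exec w (reach u v) s t s' ∧
      t + 90 * pending n W (s'.warr 0) ≤ 184 * (n / W + 3) + 90 * pending n W (s.warr 0) ∧
      (∀ c, s'.warr 0 c ≤ W) ∧
      (∀ j < n, Passed W (s'.warr 0) j → X j ≤ s'.rreg 3) ∧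
      (s'.wreg 4 = 0 ∧ (∀ z ∈ front X Y n, p.1 ≤ z.1 → sqDist p z ≤ lam * lam) ∨
        s'.wreg 4 = 1 ∧ (s'.rreg 4, s'.rreg 5) ∈ front X Y n ∧ p.1 < s'.rreg 4 ∧
          s'.rreg 3 < s'.rreg 4 ∧
          ∀ z ∈ front X Y n, p.1 ≤ z.1 → (z.1 < s'.rreg 4 ↔ sqDist p z ≤ lam * lam)) := by
  have hN := Nat.zero_le (n / W)
  obtain ⟨t₁, s₁, e₁, ht₁, h₁, h₂⟩ := (Program.seq (.rset 1 (.reg u)) (.rset 2 (.reg v))).exec_of_wp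
    (w := w) (s := s) (Q := fun s' => s'.rreg 1 = p.1 ∧ s'.rreg 2 = p.2)
    (by simp [Program.wp, RExp.eval, Function.update_of_ne hv, hp₁, hp₂])
  have f₁ := e₁.frame
  have hs₁ := hs.of_frame f₁ rfl rfl rfl rfl rfl
  have hw₁ : s₁.warr 0 = s.warr 0 := f₁.warr 0 rfl
  have hq₁ : s₁.rreg 3 = s.rreg 3 := f₁.rreg 3 rfl
  obtain ⟨t₂, s₂, e₂, ht₂, ho₂, hpass₂, hnear⟩ := exec_passNear hw hW hs₁ hXY hp h₁ h₂
    (hw₁ ▸ ho) (by rwa [hw₁, hq₁]) (by rwa [hq₁])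
  have hs₂ := hs₁.of_frame e₂.frame rfl rfl rfl rfl rfl
  have e₃ := Exec.wset (w := w) 4 (.const 0) s₂
  have f₃ := e₃.frame
  obtain ⟨t₄, s₄, e₄, ht₄, ho₄, hpass₄, hres⟩ := exec_findNext hw hW
    (hs₂.of_frame f₃ rfl rfl rfl rfl rfl) hXY ho₂ hpass₂ (by simp [WExp.eval])
  have hq₄ : s₄.rreg 3 = s₂.rreg 3 := e₄.frame.rreg 3 rfl
  dsimp only at hpass₄ hres ht₄
  have hpq := (hnear p hp le_rfl).2 (sqDist_self_le p lam)
  refine ⟨_, s₄, .seq e₁ (.seq e₂ (.seq e₃ e₄)), ?_, ho₄, by rwa [hq₄], ?_⟩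
  · have hb₁ : (Program.seq (.rset 1 (.reg u)) (.rset 2 (.reg v))).bound = 4 := rfl
    have hb₃ : (WExp.const 0).cost = 1 := rfl
    rw [hw₁] at ht₂
    omega
  · rcases hres with ⟨h, hall⟩ | ⟨h, hf, hlt, hall⟩
    · exact .inl ⟨h, fun z hz hpz => (hnear z hz hpz).1 (hall z hz)⟩
    · refine .inr ⟨h, hf, hpq.trans_lt hlt, hq₄ ▸ hlt, fun z hz hpz => ?_⟩
      rw [← hnear z hz hpz]
      refine ⟨fun h' => ?_, fun h' => h'.trans_lt hlt⟩
      by_contra! hc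
      exact absurd (hall z hz hc) (not_le.2 h')

/-- The invariant of the greedy algorithm: the assertion `G` is equivalent to the coverability of
the points from `l` on by the remaining `k` discs. -/
structure GreedyInv (X Y : ℕ → ℝ) (n W : ℕ) (lam : ℝ) (G : Prop) (k : ℕ) (s : State) : Prop where
  setup : Setup X Y n W lam s
  le₀ : ∀ c, s.warr 0 c ≤ W
  le₁ : ∀ c, s.warr 1 c ≤ W
  mem : (s.rreg 4, s.rreg 5) ∈ front X Y n
  passed₀ : ∀ j < n, Passed W (s.warr 0) j → X j ≤ s.rreg 3
  gap : ∀ z ∈ front X Y n, s.rreg 4 < z.1 → s.rreg 3 < z.1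
  passed₁ : ∀ j < n, Passed W (s.warr 1) j → HighLe (Y j, X j) (s.rreg 7, s.rreg 6)
  last_mem : ∃ j < n, X j = s.rreg 6 ∧ Y j = s.rreg 7
  le_last : s.rreg 5 ≤ s.rreg 7
  iff_coverable : G ↔ Coverable (front X Y n) lam k (s.rreg 4)

theorem GreedyInv.of_frame {G : Prop} {k : ℕ} {s s' : State} {c : Program}
    (h : GreedyInv X Y n W lam G k s) (f : Frame c s s') (h₁ : c.setsW 0 = false)
    (h₂ : c.setsW 2 = false) (h₃ : c.storesR = fun _ => false) (h₄ : c.storesW = fun _ => false)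
    (h₅ : c.setsR = fun _ => false) : GreedyInv X Y n W lam G k s' := by
  have e₀ := f.warr 0 (by rw [h₄])
  have e₁ := f.warr 1 (by rw [h₄])
  have hr : s'.rreg = s.rreg := funext fun v => f.rreg v (by rw [h₅])
  obtain ⟨a, b, c, d, e, g, i, j, k, l⟩ := h
  refine ⟨a.of_frame f h₁ h₂ (by rw [h₃]) (by rw [h₃]) (by rw [h₅]), ?_, ?_, ?_, ?_, ?_, ?_, ?_, ?_,
    ?_⟩ <;> simpa only [e₀, e₁, hr]

/-- One greedy step along `l`, `f`, `c`, `m`. If no `f` or no `m` exists, one disc finishes the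
covering; otherwise `coverable_succ_iff` passes from `l` to `m`. -/
theorem exec_round_body (hw : n + W + 1 < 2 ^ w) (hW : 0 < W) (hXY : StairBlocks X Y n W) {G : Prop}
    {k : ℕ} (H : GreedyInv X Y n W lam G (k + 1) s) :
    ∃ t s', Exec w (.seq (reach 4 5)
        (.branch (.wlt (.const 0) (.reg 4)) (.seq findLast (reach 6 7)) .skip)) s t s' ∧
      t + 90 * pending n W (s'.warr 0) + 90 * pending n W (s'.warr 1) ≤ 470 * (n / W + 3) +
        90 * pending n W (s.warr 0) + 90 * pending n W (s.warr 1) ∧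
      (s'.wreg 4 = 0 ∧ G ∨ s'.wreg 4 = 1 ∧ GreedyInv X Y n W lam G k s') := by
  have hN := Nat.zero_le (n / W)
  have hS := staircase_front X Y n
  have hc : (BExp.wlt (.const 0) (.reg 4)).cost = 3 := rfl
  obtain ⟨t₁, s₁, e₁, ht₁, ho₁, hpass₁, hres₁⟩ := exec_reach (u := 4) (v := 5) hw hW H.setup hXY
    (by decide) H.mem rfl rfl H.le₀ H.passed₀ H.gap
  have f₁ := e₁.frame
  have hs₁ := H.setup.of_frame f₁ rfl rfl rfl rfl rfl
  have hw₁ : s₁.warr 1 = s.warr 1 := f₁.warr 1 rfl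
  have h6₁ : s₁.rreg 6 = s.rreg 6 := f₁.rreg 6 rfl
  have h7₁ : s₁.rreg 7 = s.rreg 7 := f₁.rreg 7 rfl
  have hl := H.mem
  set l : ℝ × ℝ := (s.rreg 4, s.rreg 5) with hldef
  rcases hres₁ with ⟨h4, hall⟩ | ⟨h4, hf, hlf, hqf, hiff⟩
  · refine ⟨_, s₁, .seq e₁ (.branch_false _ (by simp [BExp.Holds, WExp.eval, h4]) (.skip s₁)),
      by rw [hw₁]; omega, .inl ⟨h4, ?_⟩⟩
    exact H.iff_coverable.2
      (coverable_succ_of_forall hS hl hl (sqDist_self_le l lam) hall)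
  · set f : ℝ × ℝ := (s₁.rreg 4, s₁.rreg 5) with hfdef
    have hfl : f.2 < l.2 := lt_of_mem_front hl hf hlf
    obtain ⟨t₂, s₂, e₂, ht₂, ho₂, hpass₂, hc₂, hlt₂, hlast⟩ := exec_findLast hw hW hs₁ hXY
      (hw₁ ▸ H.le₁) (by rw [hw₁, h6₁, h7₁]; exact H.passed₁) (by rw [h6₁, h7₁]; exact H.last_mem)
      (by rw [h7₁]; exact hfl.trans_le H.le_last)
    set c : ℝ × ℝ := (s₂.rreg 6, s₂.rreg 7) with hcdef
    have f₂ := e₂.frame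
    have hs₂ := hs₁.of_frame f₂ rfl rfl rfl rfl rfl
    have hw₂ : s₂.warr 0 = s₁.warr 0 := f₂.warr 0 rfl
    have hq₂ : s₂.rreg 3 = s₁.rreg 3 := f₂.rreg 3 rfl
    have hlc : l.1 ≤ c.1 := hlast l hl hfl
    have hcf : c.1 < f.1 := by
      by_contra! h
      exact absurd (hS f hf c hc₂ h).1 (not_le.2 hlt₂)
    -- No skyline point lies strictly between `c` and `f`. Hence the points passed from `l`, all to
    -- the left of `f`, do not disturb the second search, which starts at `c`.
    have hnext : ∀ z ∈ front X Y n, c.1 < z.1 → f.1 ≤ z.1 := fun z hz hz' => by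
      by_contra! h
      exact absurd (hlast z hz (lt_of_mem_front hz hf h)) (not_le.2 hz')
    obtain ⟨t₃, s₃, e₃, ht₃, ho₃, hpass₃, hres₃⟩ := exec_reach (u := 6) (v := 7) hw hW hs₂ hXY
      (by decide) hc₂ rfl rfl (hw₂ ▸ ho₁) (by rwa [hw₂, hq₂])
      (fun z hz hz' => by rw [hq₂]; exact hqf.trans_le (hnext z hz hz'))
    have f₃ := e₃.frame
    have hw₃ : s₃.warr 1 = s₂.warr 1 := f₃.warr 1 rfl
    refine ⟨_, s₃, .seq e₁ (.branch_true _ ?_ (.seq e₂ e₃)), ?_, ?_⟩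
    · simp [BExp.Holds, WExp.eval, h4]
    · rw [hw₂] at ht₃
      rw [hw₁] at ht₂
      rw [hw₃, hc]
      omega
    · have hd : sqDist l c ≤ lam * lam := (hiff c hc₂ hlc).1 hcf
      rcases hres₃ with ⟨h4', hall⟩ | ⟨h4', hm, hcm, hqm, hiff'⟩
      · exact .inl ⟨h4', H.iff_coverable.2 (coverable_succ_of_forall hS hl hc₂ hd hall)⟩
      · refine .inr ⟨h4', hs₂.of_frame f₃ rfl rfl rfl rfl rfl, ho₃, hw₃ ▸ ho₂, hm, hpass₃,
          fun z _ hz => hqm.trans hz, ?_, ?_, ?_, ?_⟩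
        · rw [hw₃, f₃.rreg 6 rfl, f₃.rreg 7 rfl]
          exact hpass₂
        · rw [f₃.rreg 6 rfl, f₃.rreg 7 rfl]
          exact hc₂.1
        · rw [f₃.rreg 7 rfl]
          exact (lt_of_mem_front hc₂ hm hcm).le
        · refine H.iff_coverable.trans (coverable_succ_iff hS hl hc₂ hm hlc hcm.le hd ?_ ?_ ?_)
          · intro z hz hcz
            rw [← not_le, ← hiff z hz (hlc.trans hcz.le), not_lt]
            exact hnext z hz hcz
          · rw [← not_le, ← hiff' _ hm hcm.le]
            exact lt_irrefl _
          · exact fun z hz h₁ h₂ => (hiff' z hz h₁).1 h₂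

theorem exec_round (hw : n + W + 1 < 2 ^ w) (hW : 0 < W) (hXY : StairBlocks X Y n W) {G : Prop}
    {k : ℕ} (H : GreedyInv X Y n W lam G (k + 1) s) (hk : s.wreg 1 = k + 1) (h5 : s.wreg 5 = 0) :
    ∃ t s', Exec w round s t s' ∧
      t + 90 * pending n W (s'.warr 0) + 90 * pending n W (s'.warr 1) ≤ 490 * (n / W + 3) +
        90 * pending n W (s.warr 0) + 90 * pending n W (s.warr 1) ∧
      s'.wreg 1 = k ∧ (s'.wreg 5 = 1 ∧ G ∨ s'.wreg 5 = 0 ∧ GreedyInv X Y n W lam G k s') := by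
  have hN := Nat.zero_le (n / W)
  obtain ⟨t₁, s₁, e₁, ht₁, hres⟩ := exec_round_body hw hW hXY H
  have h₁ : 1 % 2 ^ w = 1 := Nat.mod_eq_of_lt (by omega)
  have hk₁ : s₁.wreg 1 = k + 1 := (e₁.frame.wreg 1 rfl).trans hk
  have h5₁ : s₁.wreg 5 = 0 := (e₁.frame.wreg 5 rfl).trans h5
  obtain ⟨t₂, s₂, e₂, ht₂, hk₂, h5₂⟩ := (Program.seq
    (.branch (.wlt (.const 0) (.reg 4)) .skip (.wset 5 (.const 1)))
    (.wset 1 (.sub (.reg 1) (.const 1)))).exec_of_wp (w := w) (s := s₁)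
    (Q := fun s' => s'.wreg 1 = k ∧ s'.wreg 5 = if s₁.wreg 4 = 0 then 1 else 0)
    (by
      simp only [Program.wp, BExp.Holds, WExp.eval]
      simp only [h₁, hk₁, Nat.zero_mod]
      refine ⟨fun h => ?_, fun h => ?_⟩
      · simp [h.ne', h5₁]
      · simp [show s₁.wreg 4 = 0 by omega, hk₁])
  have f₂ := e₂.frame
  have hw₀ : s₂.warr 0 = s₁.warr 0 := f₂.warr 0 rfl
  have hw₁ : s₂.warr 1 = s₁.warr 1 := f₂.warr 1 rfl
  have hb : (Program.seq (.branch (.wlt (.const 0) (.reg 4)) .skip (.wset 5 (.const 1)))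
    (.wset 1 (.sub (.reg 1) (.const 1)))).bound = 11 := rfl
  -- The executions are taken apart to match the right-nested composition in `round`.
  cases e₁ with
  | seq a b =>
    cases e₂ with
    | seq c d =>
      refine ⟨_, s₂, .seq a (.seq b (.seq c d)), ?_, hk₂, ?_⟩
      · rw [hw₀, hw₁]
        omega
      · rcases hres with ⟨h, hG⟩ | ⟨h, hinv⟩
        · exact .inl ⟨by rw [h5₂, h, if_pos rfl], hG⟩
        · refine .inr ⟨by rw [h5₂, h, if_neg one_ne_zero], hinv.of_frame f₂ rfl rfl ?_ ?_ ?_⟩ <;>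
            rfl

/-- If the loop ends with no centre left and the flag unset, the point `l` is still uncovered, which
refutes coverability by `0` discs. The excess of `500` over the cost `490` of a round pays for the
loop test. -/
theorem exec_rounds (hw : n + W + 1 < 2 ^ w) (hW : 0 < W) (hXY : StairBlocks X Y n W) {G : Prop}
    {k : ℕ} (H : GreedyInv X Y n W lam G k s) (hk : s.wreg 1 = k) (h5 : s.wreg 5 = 0) :
    ∃ t s', Exec w rounds s t s' ∧
      t ≤ 500 * (n / W + 3) * k + 90 * pending n W (s.warr 0) + 90 * pending n W (s.warr 1) + 10 ∧
      (G → s'.wreg 5 = 1) ∧ (¬ G → s'.wreg 5 = 0) := by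
  have hc : (BExp.and (.wlt (.const 0) (.reg 1)) (.wlt (.reg 5) (.const 1))).cost = 7 := rfl
  have h₁ : 1 % 2 ^ w = 1 := Nat.mod_eq_of_lt (by omega)
  obtain ⟨t, s', e, f, hI, hb, ht⟩ := exec_loop (w := w)
    (b := .and (.wlt (.const 0) (.reg 1)) (.wlt (.reg 5) (.const 1))) (c := round)
    (fun s => s.wreg 5 = 1 ∧ G ∨ s.wreg 5 = 0 ∧ GreedyInv X Y n W lam G (s.wreg 1) s)
    (fun s => 500 * (n / W + 3) * s.wreg 1 + 90 * pending n W (s.warr 0) +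
      90 * pending n W (s.warr 1)) (s₀ := s) (.inr ⟨h5, by rwa [hk]⟩) fun s f hI hb => by
      simp only [BExp.Holds, WExp.eval, h₁, Nat.zero_mod] at hb
      obtain ⟨k, hk⟩ : ∃ k, s.wreg 1 = k + 1 := ⟨s.wreg 1 - 1, by omega⟩
      have hI := hI.resolve_left (by omega)
      rw [hk] at hI
      obtain ⟨t, s', e, ht, hk', hI'⟩ := exec_round hw hW hXY hI.2 hk hI.1
      refine ⟨t, s', e, by rwa [hk'], ?_⟩
      rw [hk, hk', hc, mul_add _ k, mul_one]
      have hN := Nat.zero_le (n / W)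
      omega
  refine ⟨t, s', e, by rw [hk] at ht; omega, ?_⟩
  simp only [BExp.Holds, WExp.eval, h₁, Nat.zero_mod, not_and] at hb
  rcases hI with ⟨h, hG⟩ | ⟨h, hI⟩
  · exact ⟨fun _ => h, fun h' => absurd hG h'⟩
  · refine ⟨fun hG => ?_, fun _ => h⟩
    have hk₀ : s'.wreg 1 = 0 := by
      by_contra hne
      exact hb (by omega) (by omega)
    have := hI.iff_coverable.1 hG
    rw [hk₀] at this
    exact absurd this (not_coverable_zero hI.mem)

/-- Initialization of the greedy algorithm. -/
def greedyInit : Program :=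
  .seq (.rset 3 (.reg 4)) <|
  .seq (.rset 6 (.reg 4)) <|
  .rset 7 (.reg 5)

/-- The decision algorithm. -/
def decideOpt : Program :=
  .seq sortBlocks <|
  .seq stairs <|
  .seq greedyInit <|
  .seq rounds <|
  .wset 0 (.reg 5)

/-- The constant of the running time of the decision algorithm. -/
def decideOptConst : ℕ :=
  18 * (mergeStep.bound + copyStep.bound + 50) + 4 * (stairStep.bound + 20) + 6000

theorem exec_decideOpt {w n k : ℕ} (p : Fin n → Plane) {lam : ℝ} (hw : 5 * n + 1 < 2 ^ w)
    (hn : 0 < n) (hlam : 0 ≤ lam) :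
    ∃ t s, Exec w decideOpt (decisionInput p k lam) t s ∧
      t ≤ ((mergeStep.bound + copyStep.bound + 50) * (n + 1) + 4) * (Nat.clog 2 (min k n) + 3) +
        (stairStep.bound + 20) * (n + 1) + 2560 * n ∧
      (opt (Set.range p) k ≤ ENNReal.ofReal lam → s.wreg 0 = 1) ∧
      (¬ opt (Set.range p) k ≤ ENNReal.ofReal lam → s.wreg 0 = 0) := by
  set s₀ := decisionInput p k lam with hs₀
  obtain ⟨t₁, s₁, W, e₁, ht₁, hW₁, hk₁, hW, hWn, hkW, hsame, hsort⟩ := exec_sortBlocks (k := k)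
    (s := s₀) hw hn rfl rfl
  have f₁ := e₁.frame
  have hn₁ : s₁.wreg 0 = n := f₁.wreg 0 rfl
  obtain ⟨t₂, s₂, e₂, ht₂, hXY, hfront, hhigh⟩ := exec_stairs (w := w) (by omega) hn hn₁ hW₁ hsort
  have f₂ := e₂.frame
  obtain ⟨t₃, s₃, e₃, ht₃, h₃, h₆, h₇⟩ := greedyInit.exec_of_wp (w := w) (s := s₂)
    (Q := fun s' => s'.rreg 3 = s₂.rreg 4 ∧ s'.rreg 6 = s₂.rreg 4 ∧ s'.rreg 7 = s₂.rreg 5)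
    (by simp [greedyInit, Program.wp, RExp.eval])
  have f₃ := e₃.frame
  have h₄ : s₃.rreg 4 = s₂.rreg 4 := f₃.rreg 4 rfl
  have h₅ : s₃.rreg 5 = s₂.rreg 5 := f₃.rreg 5 rfl
  have hwarr : ∀ a, s₃.warr a = fun _ => 0 := fun a =>
    (f₃.warr a rfl).trans ((f₂.warr a rfl).trans (f₁.warr a rfl))
  have hfront₀ : front (s₂.rarr 0) (s₂.rarr 1) n = front (s₀.rarr 0) (s₀.rarr 1) n :=
    hfront.trans (front_congr_of_samePoints hsame)
  have hnp : ∀ a j, ¬ Passed W (s₃.warr a) j := fun a j => by simp [Passed, hwarr]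
  have hk₃ : s₃.wreg 1 = min k n := (f₃.wreg 1 rfl).trans ((f₂.wreg 1 rfl).trans hk₁)
  -- No pointer has moved yet. The first skyline point serves as `l`, as the passed abscissa and as
  -- the initial rightmost candidate.
  have hinv : GreedyInv (s₂.rarr 0) (s₂.rarr 1) n W lam
      (opt (Set.range p) k ≤ ENNReal.ofReal lam) (min k n) s₃ := by
    refine ⟨⟨(f₃.wreg 0 rfl).trans ((f₂.wreg 0 rfl).trans hn₁),
      (f₃.wreg 2 rfl).trans ((f₂.wreg 2 rfl).trans hW₁), f₃.rarr 0 rfl, f₃.rarr 1 rfl,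
      (f₃.rreg 0 rfl).trans ((f₂.rreg 0 rfl).trans (f₁.rreg 0 rfl))⟩, by simp [hwarr],
      by simp [hwarr], ?_, fun j _ h => absurd h (hnp 0 j), ?_, fun j _ h => absurd h (hnp 1 j),
      ?_, ?_, ?_⟩
    · rw [h₄, h₅]
      exact hhigh.mem_front
    · rw [h₃, h₄]
      exact fun z _ h => h
    · rw [h₆, h₇]
      exact hhigh.mem_front.1
    · rw [h₅, h₇]
    · rw [h₄]
      exact opt_le_iff_coverable p k hlam hfront₀ (fun i => by simp [hs₀, decisionInput])
        (fun i => by simp [hs₀, decisionInput]) hhigh.le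
  have h5₃ : s₃.wreg 5 = 0 :=
    (f₃.wreg 5 rfl).trans ((f₂.wreg 5 rfl).trans (f₁.wreg 5 rfl))
  obtain ⟨t₄, s₄, e₄, ht₄, hyes, hno⟩ := exec_rounds (w := w) (by omega) hW hXY hinv hk₃ h5₃
  refine ⟨_, _, .seq e₁ (.seq e₂ (.seq e₃ (.seq e₄ (.wset 0 (.reg 5) s₄)))), ?_, ?_, ?_⟩
  · have hp := pending_zero n W
    rw [hwarr, hwarr] at ht₄
    have hb : greedyInit.bound = 6 := rfl
    have hc : (WExp.reg 5).cost = 1 := rfl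
    -- Here `min k n ≤ W` makes the rounds linear: they cost `500 * (4 * n)`. The two families of
    -- pointers cost `2 * 90 * (n + W)`, at most `540 * n` by `W ≤ 2 * n`, and `20 * n` covers the
    -- constants; the sum is `2560 * n`.
    have h₈ : (n / W + 3) * min k n ≤ 4 * n := by
      have h₁ : n / W * min k n ≤ n :=
        (Nat.mul_le_mul_left _ hkW).trans (Nat.div_mul_le_self n W)
      have h₂ : min k n ≤ n := min_le_right _ _
      rw [add_mul]
      omega
    rw [mul_assoc] at ht₄
    omega
  · exact fun h => by simpa [WExp.eval] using hyes h
  · exact fun h => by simpa [WExp.eval] using hno h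

end RealRAM

/-! ### The final bound on the running time -/

theorem clog_min_le (k n : ℕ) : (Nat.clog 2 (min k n) : ℝ) ≤ 3 * Real.log (k + 1) := by
  have hlog : 0 ≤ Real.log (k + 1) := Real.log_nonneg (by linarith [Nat.cast_nonneg (α := ℝ) k])
  have hlog2 := Real.log_two_gt_d9
  -- For `k > 1` the power exceeds `k` by less than a factor `2`, and `2 * k ≤ (k + 1) ^ 2`. The
  -- constant `3` then comes from `2 / log 2 < 3`.
  have h : 2 ^ Nat.clog 2 (min k n) ≤ (k + 1) ^ 2 := by
    refine (Nat.pow_le_pow_right two_pos (Nat.clog_mono_right 2 (min_le_left k n))).trans ?_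
    rcases Nat.lt_or_ge 1 k with hk | hk
    · have h₁ := Nat.pow_pred_clog_lt_self one_lt_two hk
      have h₂ : 0 < Nat.clog 2 k := Nat.clog_pos one_lt_two hk
      obtain ⟨m, hm⟩ := Nat.exists_eq_succ_of_ne_zero h₂.ne'
      rw [hm, Nat.pred_succ] at h₁
      rw [hm, pow_succ]
      nlinarith
    · rw [Nat.clog_of_right_le_one hk]
      nlinarith
  have h' : (2 : ℝ) ^ Nat.clog 2 (min k n) ≤ ((k : ℝ) + 1) ^ 2 := by exact_mod_cast h
  have := Real.log_le_log (by positivity) h'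
  rw [Real.log_pow, Real.log_pow] at this
  push_cast at this
  have hc : (0 : ℝ) ≤ Nat.clog 2 (min k n) := Nat.cast_nonneg _
  nlinarith

theorem RealRAM.decideOpt_time_le {A B n c t : ℕ} {L : ℝ} (hn : 0 < n) (hL : 1 ≤ 2 * L)
    (hc : (c : ℝ) ≤ 3 * L) (ht : t ≤ (A * (n + 1) + 4) * (c + 3) + B * (n + 1) + 2560 * n) :
    (t : ℝ) ≤ ((18 * A + 4 * B + 6000 : ℕ) : ℝ) * (n * L) := by
  have hn' : (1 : ℝ) ≤ n := by exact_mod_cast hn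
  have ht' : (t : ℝ) ≤ (A * (n + 1) + 4) * (c + 3) + B * (n + 1) + 2560 * n := by exact_mod_cast ht
  push_cast
  have hA : (0 : ℝ) ≤ A := Nat.cast_nonneg A
  have hB : (0 : ℝ) ≤ B := Nat.cast_nonneg B
  -- The assumption `1 ≤ 2 * L` absorbs lower-order terms: `c + 3 ≤ 9 * L`, and terms linear in `n`
  -- become multiples of `n * L`.
  have hnL : (n : ℝ) ≤ 2 * (n * L) := by nlinarith
  calc (t : ℝ) ≤ (A * (n + 1) + 4) * (c + 3) + B * (n + 1) + 2560 * n := ht'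
    _ ≤ (A * (2 * n) + 4 * n) * (9 * L) + B * (2 * n) + 2560 * n := by
        gcongr <;> nlinarith
    _ = (18 * A + 36) * (n * L) + (2 * B + 2560) * n := by ring
    _ ≤ (18 * A + 36) * (n * L) + (2 * B + 2560) * (2 * (n * L)) := by gcongr
    _ ≤ (18 * A + 4 * B + 6000) * (n * L) := by nlinarith

theorem mainTheorem2 :
    ∃ (prog : RealRAM.Program) (C : ℕ),
      ∀ (n : ℕ) (p : Fin n → Plane) (k : ℕ) (lam : ℝ) (w : ℕ),
        0 < n → Function.Injective p → 0 < k → 0 ≤ lam → C * (n + k) ≤ 2 ^ w →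
          ∃ (t : ℕ) (s : RealRAM.State),
            RealRAM.Exec w prog (decisionInput p k lam) t s ∧
            (t : ℝ) ≤ C * (n * Real.log (k + 1)) ∧
            (opt (Set.range p) k ≤ ENNReal.ofReal lam → s.wreg 0 = 1) ∧
            (ENNReal.ofReal lam < opt (Set.range p) k → s.wreg 0 = 0) := by
  refine ⟨RealRAM.decideOpt, RealRAM.decideOptConst, fun n p k lam w hn _ hk hlam hw => ?_⟩
  have hC : 6000 ≤ RealRAM.decideOptConst := Nat.le_add_left _ _
  have hw' : 5 * n + 1 < 2 ^ w := by
    have := Nat.mul_le_mul_right (n + k) hC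
    omega
  obtain ⟨t, s, e, ht, hyes, hno⟩ := RealRAM.exec_decideOpt (k := k) p hw' hn hlam
  refine ⟨t, s, e, ?_, hyes, fun h => hno (not_le.2 h)⟩
  -- Since `k ≥ 1`, the logarithm is at least `log 2 > 1 / 2`, so the bound also covers the linear
  -- cost for `k = 1`.
  have hL : 1 ≤ 2 * Real.log (k + 1) := by
    have h₁ := Real.log_two_gt_d9
    have h₂ : Real.log 2 ≤ Real.log (k + 1) := by
      have : (1 : ℝ) ≤ k := by exact_mod_cast hk
      exact Real.log_le_log two_pos (by linarith)
    linarith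
  exact RealRAM.decideOpt_time_le hn hL (clog_min_le k n) ht
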